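/- Let $(R,\mathfrak m)$ be a regular local ring of dimension $n$ and of prime characteristic $p>0$, and let $0\neq f\in\mathfrak m$. For $q=p^e$ let $\mathfrak m^{[q]}=(y^q\mid y\in\mathfrak m)$, and put $$\nu_f(q)=\max\{r\in\mathbb N\mid f^r\notin\mathfrak m^{[q]}\},\qquad c(f)=\lim_{e\to\infty}\frac{\nu_f(p^e)}{p^e}$$ ($c(f)$ is the F-pure threshold of $f$). Then: 1. $c(f)=1$ if and only if there is some $e\ge 1$ such that $\nu_f(p^e)=p^e-1$. 2. $c(f)=1$ if and only if the Frobenius action on the local cohomology module $H^{n-1}_{\mathfrak m}(R/(f))$ is injective. Here, for a regular system of parameters $x_1,\dots,x_n$ of $R$ (any choice is allowed) and $S=R/(f)$, the module $H^{k}_{\mathfrak m}(S)$ is the $k$-th cohomology of the Čech complex $$0\to S\to\bigoplus_i S_{x_i}\to\bigoplus_{i<j}S_{x_ix_j}\to\cdots\to S_{x_1\cdots x_n}\to 0,$$ and the Frobenius action on it is the $p$-linear map induced by the $p$-th power map on each localization $S_{x_{i_1}\cdots x_{i_k}}$. -/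

import Mathlib

open Filter Topology IsLocalRing

noncomputable section

namespace FThreshold

universe u v

/-! ### Frobenius powers, the function `ν`, and F-thresholds -/

/-- `I^[q]`, the ideal generated by the `q`-th powers of the elements of `I`. -/
def frobeniusPower {R : Type u} [CommRing R] (I : Ideal R) (q : ℕ) : Ideal R :=
  Ideal.span ((fun y : R => y ^ q) '' (I : Set R))

/-- `ν_𝔞^J(q) = max {r | 𝔞^r ⊄ J^[q]}`. -/
def nu {R : Type u} [CommRing R] (a J : Ideal R) (q : ℕ) : ℕ :=
  sSup {r : ℕ | ¬ a ^ r ≤ frobeniusPower J q}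

/-- The F-threshold `c^J(𝔞) = lim_{e → ∞} ν_𝔞^J(p^e) / p^e`. -/
def threshold {R : Type u} [CommRing R] (p : ℕ) (a J : Ideal R) : ℝ :=
  limUnder atTop (fun e : ℕ => (nu a J (p ^ e) : ℝ) / (p : ℝ) ^ e)

/-- `ν_f(q) = ν_{(f)}^𝔪(q)` for an element `f` of a local ring `(R, 𝔪)`. -/
abbrev nuElem {R : Type u} [CommRing R] [IsLocalRing R] (f : R) (q : ℕ) : ℕ :=
  nu (Ideal.span {f}) (maximalIdeal R) q

/-- `c(f) = c^𝔪((f))`, the F-pure threshold of an element `f` of a local ring `(R, 𝔪)`. -/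
abbrev pureThreshold {R : Type u} [CommRing R] [IsLocalRing R] (p : ℕ) (f : R) : ℝ :=
  threshold p (Ideal.span {f}) (maximalIdeal R)

/-! The maximum and the limit in these definitions are genuine for `0 ≠ f ∈ 𝔪`. -/

theorem span_pow_le_iff {R : Type u} [CommRing R] (f : R) (I : Ideal R) (r : ℕ) :
    Ideal.span {f} ^ r ≤ I ↔ f ^ r ∈ I := by
  rw [Ideal.span_singleton_pow, Ideal.span_singleton_le_iff_mem]

theorem isGreatest_nuElem {R : Type u} [CommRing R] [IsLocalRing R] {f : R}
    (hf : f ∈ maximalIdeal R) {q : ℕ} (hq : q ≠ 0) :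
    IsGreatest {r : ℕ | f ^ r ∉ frobeniusPower (maximalIdeal R) q} (nuElem f q) ∧
      nuElem f q < q := by
  have hset : {r : ℕ | ¬ Ideal.span {f} ^ r ≤ frobeniusPower (maximalIdeal R) q} =
      {r : ℕ | f ^ r ∉ frobeniusPower (maximalIdeal R) q} := by
    ext r; simp only [Set.mem_ofPred_eq, span_pow_le_iff]
  have hle : frobeniusPower (maximalIdeal R) q ≤ maximalIdeal R := by
    refine Ideal.span_le.2 ?_
    rintro _ ⟨y, hy, rfl⟩
    exact Ideal.pow_mem_of_mem _ hy _ (Nat.pos_of_ne_zero hq)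
  have hne : (0 : ℕ) ∈ {r : ℕ | f ^ r ∉ frobeniusPower (maximalIdeal R) q} := by
    intro h
    rw [pow_zero] at h
    exact (Ideal.ne_top_iff_one _).1 (maximalIdeal.isMaximal R).ne_top (hle h)
  have hlt : ∀ r ∈ {r : ℕ | f ^ r ∉ frobeniusPower (maximalIdeal R) q}, r < q := by
    intro r hr
    by_contra hqr
    exact hr (Ideal.pow_mem_of_pow_mem _ (Ideal.subset_span ⟨f, hf, rfl⟩) (not_lt.1 hqr))
  have hbdd : BddAbove {r : ℕ | f ^ r ∉ frobeniusPower (maximalIdeal R) q} :=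
    ⟨q, fun r hr => (hlt r hr).le⟩
  have hmem := Nat.sSup_mem ⟨0, hne⟩ hbdd
  have hdef : nuElem f q = sSup {r : ℕ | f ^ r ∉ frobeniusPower (maximalIdeal R) q} := by
    unfold nuElem nu; rw [hset]
  rw [hdef]
  exact ⟨⟨hmem, fun r hr => le_csSup hbdd hr⟩, hlt _ hmem⟩

theorem tendsto_pureThreshold {R : Type u} [CommRing R] [IsLocalRing R] (p : ℕ)
    [Fact p.Prime] [CharP R p] {f : R} (hf : f ∈ maximalIdeal R) :
    Tendsto (fun e : ℕ => (nuElem f (p ^ e) : ℝ) / (p : ℝ) ^ e) atTop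
      (𝓝 (pureThreshold p f)) := by
  have hp : p.Prime := Fact.out
  have hp0 : (0 : ℝ) < p := by exact_mod_cast hp.pos
  have key : ∀ e, nuElem f (p ^ (e + 1)) + 1 ≤ p * (nuElem f (p ^ e) + 1) := by
    intro e
    obtain ⟨⟨-, h1⟩, -⟩ := isGreatest_nuElem hf (pow_ne_zero e hp.ne_zero)
    obtain ⟨⟨h2, -⟩, -⟩ := isGreatest_nuElem hf (pow_ne_zero (e + 1) hp.ne_zero)
    by_contra hcon
    have hin : f ^ (nuElem f (p ^ e) + 1) ∈ frobeniusPower (maximalIdeal R) (p ^ e) := by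
      by_contra h
      exact absurd (h1 h) (by omega)
    have hfr : ∀ u ∈ frobeniusPower (maximalIdeal R) (p ^ e),
        u ^ p ∈ frobeniusPower (maximalIdeal R) (p ^ (e + 1)) := by
      intro u hu
      have : frobeniusPower (maximalIdeal R) (p ^ e) ≤
          (frobeniusPower (maximalIdeal R) (p ^ (e + 1))).comap (frobenius R p) := by
        refine Ideal.span_le.2 ?_
        rintro _ ⟨y, hy, rfl⟩
        refine Ideal.subset_span ⟨y, hy, ?_⟩
        simp [frobenius_def, pow_succ, pow_mul]
      exact this hu
    have h3 := hfr _ hin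
    rw [← pow_mul] at h3
    refine h2 (Ideal.pow_mem_of_pow_mem _ h3 ?_)
    rw [mul_comm]; omega
  have hanti : Antitone (fun e : ℕ => ((nuElem f (p ^ e) : ℝ) + 1) / (p : ℝ) ^ e) := by
    refine antitone_nat_of_succ_le fun e => ?_
    rw [div_le_div_iff₀ (by positivity) (by positivity), pow_succ (p : ℝ) e]
    have h : ((nuElem f (p ^ (e + 1)) : ℝ) + 1) ≤ p * ((nuElem f (p ^ e) : ℝ) + 1) := by
      exact_mod_cast key e
    nlinarith [pow_pos hp0 e]
  have hlim := tendsto_atTop_ciInf hanti ⟨0, by rintro _ ⟨e, rfl⟩; positivity⟩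
  have hinv : Tendsto (fun e : ℕ => (1 : ℝ) / (p : ℝ) ^ e) atTop (𝓝 0) := by
    have := tendsto_pow_atTop_nhds_zero_of_lt_one (r := (p : ℝ)⁻¹) (by positivity)
      (inv_lt_one_of_one_lt₀ (by exact_mod_cast hp.one_lt))
    simpa [one_div, inv_pow] using this
  refine tendsto_nhds_limUnder ⟨_, (hlim.sub hinv).congr fun e => ?_⟩
  ring

/-! ### Local cohomology through the Čech complex

For a commutative ring `R`, a commutative `R`-algebra `S` and a sequence `x : Fin r → R`, the
cohomology of the Čech complex `0 → S → ∏ S_{x_i} → ∏ S_{x_i x_j} → ⋯ → S_{x_1 ⋯ x_r} → 0`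
is the local cohomology `H^k_I(S)` with support in `I = (x_1, …, x_r)`. -/

section Cech

/-- The localization `S_{x_s}` of `S` at `x_s = ∏_{i ∈ s} x_i`. -/
abbrev CechLoc {R : Type u} [CommRing R] (S : Type v) [CommRing S] [Algebra R S] {r : ℕ}
    (x : Fin r → R) (s : Finset (Fin r)) : Type v :=
  Localization.Away (algebraMap R S (∏ i ∈ s, x i))

/-- The canonical ring map `S_{x_s} → S_{x_t}` for `s ⊆ t`. -/
def cechRes {R : Type u} [CommRing R] (S : Type v) [CommRing S] [Algebra R S] {r : ℕ}
    (x : Fin r → R) {s t : Finset (Fin r)} (h : s ⊆ t) : CechLoc S x s →ₐ[S] CechLoc S x t :=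
  IsLocalization.liftAlgHom (M := Submonoid.powers (algebraMap R S (∏ i ∈ s, x i)))
    (f := Algebra.ofId S (CechLoc S x t)) (by
      rintro ⟨_, n, rfl⟩
      change IsUnit (algebraMap S (CechLoc S x t) (algebraMap R S (∏ i ∈ s, x i) ^ n))
      rw [map_pow]
      refine IsUnit.pow n (isUnit_of_dvd_unit ?_
        (IsLocalization.Away.algebraMap_isUnit (algebraMap R S (∏ i ∈ t, x i))))
      exact map_dvd _ (map_dvd _ (Finset.prod_dvd_prod_of_subset _ _ _ h)))

theorem cechRes_cechRes {R : Type u} [CommRing R] (S : Type v) [CommRing S] [Algebra R S] {r : ℕ}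
    (x : Fin r → R) {s t w : Finset (Fin r)} (h : s ⊆ t) (h' : t ⊆ w) (a : CechLoc S x s) :
    cechRes S x h' (cechRes S x h a) = cechRes S x (h.trans h') a := by
  have : (cechRes S x h').comp (cechRes S x h) = cechRes S x (h.trans h') :=
    IsLocalization.algHom_ext (Submonoid.powers (algebraMap R S (∏ i ∈ s, x i)))
      (by ext)
  exact DFunLike.congr_fun this a

/-- The module `C^k = ∏_{#s = k} S_{x_s}` of Čech cochains. -/
abbrev CechCochain {R : Type u} [CommRing R] (S : Type v) [CommRing S] [Algebra R S] {r : ℕ}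
    (x : Fin r → R) (k : ℕ) : Type v :=
  ∀ s : {s : Finset (Fin r) // s.card = k}, CechLoc S x s.1

/-- The sign exponent of the face `t \ {j}` of `t`: the number of elements of `t` below `j`. -/
def below {r : ℕ} (t : Finset (Fin r)) (j : Fin r) : ℕ := (t.filter (· < j)).card

/-- The Čech differential `(d a)_t = ∑_{j ∈ t} (-1)^{#{i ∈ t | i < j}} a_{t \ {j}}`. -/
def cechD {R : Type u} [CommRing R] (S : Type v) [CommRing S] [Algebra R S] {r : ℕ}
    (x : Fin r → R) (k : ℕ) : CechCochain S x k →ₗ[R] CechCochain S x (k + 1) :=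
  LinearMap.pi fun t => ∑ j : {j // j ∈ t.1}, (-1 : R) ^ below t.1 j.1 •
    (((cechRes S x (Finset.erase_subset j.1 t.1)).toLinearMap.restrictScalars R) ∘ₗ
      LinearMap.proj (φ := fun s : {s : Finset (Fin r) // s.card = k} => CechLoc S x s.1)
        ⟨t.1.erase j.1, by rw [Finset.card_erase_of_mem j.2, t.2, Nat.add_sub_cancel]⟩)

theorem cechD_apply {R : Type u} [CommRing R] (S : Type v) [CommRing S] [Algebra R S] {r : ℕ}
    (x : Fin r → R) (k : ℕ) (a : CechCochain S x k)
    (t : {s : Finset (Fin r) // s.card = k + 1}) :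
    cechD S x k a t = ∑ j : {j // j ∈ t.1}, (-1 : R) ^ below t.1 j.1 •
      cechRes S x (Finset.erase_subset j.1 t.1)
        (a ⟨t.1.erase j.1, by rw [Finset.card_erase_of_mem j.2, t.2, Nat.add_sub_cancel]⟩) := by
  simp [cechD]

theorem below_erase {r : ℕ} {t : Finset (Fin r)} {j l : Fin r} (hj : j ∈ t) (hjl : j < l) :
    below t l = below (t.erase j) l + 1 ∧ below (t.erase l) j = below t j := by
  constructor
  · unfold below
    rw [Finset.filter_erase, Finset.card_erase_add_one]
    simp [hj, hjl]
  · unfold below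
    rw [Finset.filter_erase, Finset.erase_eq_of_notMem]
    simp [hjl.le]

/-- The Čech differential squares to zero. -/
theorem cechD_cechD {R : Type u} [CommRing R] (S : Type v) [CommRing S] [Algebra R S] {r : ℕ}
    (x : Fin r → R) (k : ℕ) (a : CechCochain S x k) :
    cechD S x (k + 1) (cechD S x k a) = 0 := by
  funext t
  have hterm : ∀ (s s' : {s : Finset (Fin r) // s.card = k}) (h : s.1 ⊆ t.1) (h' : s'.1 ⊆ t.1),
      s = s' → cechRes S x h (a s) = cechRes S x h' (a s') := by
    rintro s _ h h' rfl
    rfl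
  simp only [cechD_apply, map_sum, Finset.smul_sum, Pi.zero_apply]
  rw [Finset.sum_sigma']
  refine Finset.sum_involution
    (fun q _ => ⟨⟨q.2.1, Finset.mem_of_mem_erase q.2.2⟩,
      ⟨q.1.1, Finset.mem_erase.2 ⟨(Finset.ne_of_mem_erase q.2.2).symm, q.1.2⟩⟩⟩)
    ?_ ?_ (fun _ _ => Finset.mem_univ _) (fun _ _ => rfl)
  · rintro ⟨⟨j, hj⟩, ⟨l, hl⟩⟩ -
    have hl' : l ∈ t.1 := Finset.mem_of_mem_erase hl
    have hne : l ≠ j := Finset.ne_of_mem_erase hl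
    have hcard : ((t.1.erase j).erase l).card = k := by
      rw [Finset.card_erase_of_mem hl, Finset.card_erase_of_mem hj, t.2]; rfl
    have hsm : ∀ {u w : Finset (Fin r)} (h : u ⊆ w) (c : R) (b : CechLoc S x u),
        cechRes S x h (c • b) = c • cechRes S x h b := fun h c b =>
      ((cechRes S x h).toLinearMap.restrictScalars R).map_smul c b
    dsimp only
    rw [hsm, hsm, cechRes_cechRes, cechRes_cechRes,
      hterm ⟨(t.1.erase l).erase j, _⟩ ⟨(t.1.erase j).erase l, hcard⟩ _
        ((Finset.erase_subset _ _).trans (Finset.erase_subset _ _))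
        (Subtype.ext Finset.erase_right_comm),
      smul_smul, smul_smul, ← add_smul]
    have hzero : (-1 : R) ^ below t.1 j * (-1) ^ below (t.1.erase j) l +
        (-1) ^ below t.1 l * (-1) ^ below (t.1.erase l) j = 0 := by
      rcases lt_or_gt_of_ne hne with h | h
      · obtain ⟨h1, h2⟩ := below_erase hl' h
        rw [h1, h2, pow_succ]; ring
      · obtain ⟨h1, h2⟩ := below_erase hj h
        rw [h1, h2, pow_succ]; ring
    rw [hzero, zero_smul]
  · rintro ⟨⟨j, hj⟩, ⟨l, hl⟩⟩ - - heq
    have : l = j := congrArg (fun q => q.1.1) heq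
    exact Finset.ne_of_mem_erase hl this

/-- The Čech cocycles of degree `k`. -/
def cechZ {R : Type u} [CommRing R] (S : Type v) [CommRing S] [Algebra R S] {r : ℕ}
    (x : Fin r → R) (k : ℕ) : Submodule R (CechCochain S x k) :=
  LinearMap.ker (cechD S x k)

/-- The Čech coboundaries of degree `k`. -/
def cechB {R : Type u} [CommRing R] (S : Type v) [CommRing S] [Algebra R S] {r : ℕ}
    (x : Fin r → R) : (k : ℕ) → Submodule R (CechCochain S x k)
  | 0 => ⊥
  | k + 1 => LinearMap.range (cechD S x k)

theorem cechB_le_cechZ {R : Type u} [CommRing R] (S : Type v) [CommRing S] [Algebra R S] {r : ℕ}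
    (x : Fin r → R) (k : ℕ) : cechB S x k ≤ cechZ S x k := by
  cases k with
  | zero => exact bot_le
  | succ k =>
    rintro _ ⟨a, rfl⟩
    exact cechD_cechD S x k a

/-- The local cohomology module `H^k_{(x_1, …, x_r)}(S)`: cocycles modulo coboundaries of the
Čech complex. -/
abbrev CechH {R : Type u} [CommRing R] (S : Type v) [CommRing S] [Algebra R S] {r : ℕ}
    (x : Fin r → R) (k : ℕ) : Type v :=
  cechZ S x k ⧸ (cechB S x k).submoduleOf (cechZ S x k)

theorem add_pow_of_charP (R : Type u) [CommRing R] (p : ℕ) [Fact p.Prime] [CharP R p]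
    {A : Type v} [CommRing A] [Algebra R A] (a b : A) : (a + b) ^ p = a ^ p + b ^ p := by
  have h : (p : A) = 0 := by
    rw [← map_natCast (algebraMap R A), CharP.cast_eq_zero, map_zero]
  rw [add_pow_prime_eq Fact.out, h]
  ring

/-- The Frobenius map on Čech cochains: the `p`-th power map on each localization `S_{x_s}`. -/
def cechFrobeniusCochain {R : Type u} [CommRing R] (p : ℕ) [Fact p.Prime] [CharP R p]
    (S : Type v) [CommRing S] [Algebra R S] {r : ℕ} (x : Fin r → R) (k : ℕ) :
    CechCochain S x k →ₛₗ[frobenius R p] CechCochain S x k where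
  toFun a s := a s ^ p
  map_add' a b := funext fun s => add_pow_of_charP R p (a s) (b s)
  map_smul' c a := funext fun s => by
    simp only [Pi.smul_apply, smul_pow, frobenius_def]

/-- The Frobenius map commutes with the Čech differential. -/
theorem cechD_cechFrobeniusCochain {R : Type u} [CommRing R] (p : ℕ) [Fact p.Prime] [CharP R p]
    (S : Type v) [CommRing S] [Algebra R S] {r : ℕ} (x : Fin r → R) (k : ℕ)
    (a : CechCochain S x k) :
    cechD S x k (cechFrobeniusCochain p S x k a) =
      cechFrobeniusCochain p S x (k + 1) (cechD S x k a) := by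
  funext t
  let φ : CechLoc S x t.1 →+ CechLoc S x t.1 :=
    { toFun := fun b => b ^ p
      map_zero' := zero_pow (Fact.out : p.Prime).ne_zero
      map_add' := add_pow_of_charP R p }
  have hsign : ∀ m : ℕ, ((-1 : R) ^ m) ^ p = (-1) ^ m := by
    intro m
    rw [← frobenius_def, map_pow, map_neg, map_one]
  change _ = φ (cechD S x k a t)
  rw [cechD_apply, cechD_apply, map_sum]
  refine Finset.sum_congr rfl fun j _ => ?_
  change _ = ((-1 : R) ^ below t.1 j.1 • (_ : CechLoc S x t.1)) ^ p
  rw [smul_pow, hsign, ← map_pow]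
  rfl

/-- The Frobenius map on Čech cocycles. -/
def cechFrobeniusZ {R : Type u} [CommRing R] (p : ℕ) [Fact p.Prime] [CharP R p]
    (S : Type v) [CommRing S] [Algebra R S] {r : ℕ} (x : Fin r → R) (k : ℕ) :
    cechZ S x k →ₛₗ[frobenius R p] cechZ S x k :=
  LinearMap.codRestrict (cechZ S x k)
    ((cechFrobeniusCochain p S x k).comp (cechZ S x k).subtype) (by
      rintro ⟨a, ha⟩
      have ha' : cechD S x k a = 0 := ha
      change cechD S x k (cechFrobeniusCochain p S x k a) = 0
      rw [cechD_cechFrobeniusCochain, ha', map_zero])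

/-- The action of Frobenius on the local cohomology module `H^k_{(x_1, …, x_r)}(S)`, induced by
the `p`-th power map on the terms of the Čech complex. -/
def cechFrobenius {R : Type u} [CommRing R] (p : ℕ) [Fact p.Prime] [CharP R p]
    (S : Type v) [CommRing S] [Algebra R S] {r : ℕ} (x : Fin r → R) (k : ℕ) :
    CechH S x k →ₛₗ[frobenius R p] CechH S x k :=
  Submodule.mapQ _ _ (cechFrobeniusZ p S x k) (by
    rintro ⟨a, ha⟩ h
    change a ∈ cechB S x k at h
    change cechFrobeniusCochain p S x k a ∈ cechB S x k
    cases k with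
    | zero =>
      have h' : a = 0 := h
      rw [h', map_zero]
      exact Submodule.zero_mem _
    | succ k =>
      obtain ⟨b, rfl⟩ := h
      exact ⟨cechFrobeniusCochain p S x k b, cechD_cechFrobeniusCochain p S x k b⟩)

end Cech

end FThreshold

end

noncomputable section

namespace FThreshold

universe u v

/-! ### Regular systems of parameters -/

/-! Both equivalences pass through one condition, Fedder's: `f ^ (p - 1) ∉ (x_1 ^ p, …, x_n ^ p) =
𝔪^[p]`. Regularity of `R` enters through `mem_span_image_of_mul_mem`: a parameter is a
nonzerodivisor modulo any set of the others. It gives the cancellation `(∏ x) ^ k * c ∈ (x_i ^ (t +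
k)) → c ∈ (x_i ^ t)` (`mem_powSpan_of_prod_pow_mul_mem`). The second tool is the socle statement
`exists_mul_sub_prod_mem`: every `c ∉ (x_i ^ (t + 1))` has a multiple congruent to `(∏ x) ^ t`.

Threshold (`pureThreshold_eq_one_iff`). If `f ^ (p - 1) ∈ 𝔪^[p]`, Frobenius keeps `ν(q) / q` below
`1 - 1/p`. Otherwise `g * f ^ (p - 1) ≡ (∏ x) ^ (p - 1)` modulo `𝔪^[p]` for some `g`; iterating this
congruence gives `ν(q) = q - 1` for every `q`.

Frobenius action (`injective_cechFrobenius_iff_pow_notMem`). Since `H^(n-1)(R) = 0`, the sequence `0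
→ R → R → R/f → 0` identifies `H^(n-1)(R/f)` with the kernel of `f` on `H^n(R)`, and Frobenius with
`f ^ (p - 1) F`. A class `c / (∏ x) ^ t` of `H^n(R)` vanishes iff `c ∈ (x_i ^ t)`, and every nonzero
class has `1 / ∏ x` as a multiple. So injectivity is decided on `1 / ∏ x`, whose image is `f ^ (p -
1) / (∏ x) ^ p`. -/

theorem ringKrullDim_le_card {R : Type u} [CommRing R] [IsLocalRing R] [IsNoetherianRing R]
    {ι : Type*} [Fintype ι] (x : ι → R) (hx : Ideal.span (Set.range x) = maximalIdeal R) :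
    ringKrullDim R ≤ (Fintype.card ι : ℕ) := by
  refine (ringKrullDim_le_spanFinrank_maximalIdeal R).trans ?_
  rw [← hx]
  have h1 := Submodule.spanFinrank_span_le_ncard_of_finite (R := R) (Set.finite_range x)
  have h2 : (Set.range x).ncard ≤ Fintype.card ι := by
    rw [← Set.image_univ, ← Nat.card_eq_fintype_card, ← Set.ncard_univ]
    exact Set.ncard_image_le
  exact_mod_cast h1.trans h2

/-- If a prime principal ideal `(y)` of a Noetherian local ring is not a minimal prime, then the
ring is a domain. -/
theorem isDomain_of_prime_span_singleton {R : Type u} [CommRing R] [IsLocalRing R]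
    [IsNoetherianRing R] {y : R} (hy : (Ideal.span {y}).IsPrime)
    (hmin : Ideal.span {y} ∉ minimalPrimes R) : IsDomain R := by
  obtain ⟨P, hP, hPy⟩ := Ideal.exists_minimalPrimes_le (I := ⊥) (J := Ideal.span {y}) bot_le
  have hPp : P.IsPrime := hP.1.1
  have hyP : y ∉ P := fun h => hmin <| by
    have : Ideal.span {y} = P := le_antisymm ((Ideal.span_singleton_le_iff_mem _).2 h) hPy
    rw [this]; exact hP
  have hbot : P = ⊥ := by
    -- Nakayama: an element `w * y` of `P` has `w ∈ P` because `y ∉ P`, so `P ⊆ (y) P`.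
    refine Submodule.eq_bot_of_le_smul_of_le_jacobson_bot (Ideal.span {y}) P
      (IsNoetherian.noetherian _) ?_ ?_
    · intro z hz
      obtain ⟨w, rfl⟩ := Ideal.mem_span_singleton'.1 (hPy hz)
      have hw : w ∈ P := (hPp.mem_or_mem hz).resolve_right hyP
      rw [mul_comm]
      exact Submodule.smul_mem_smul (Ideal.mem_span_singleton_self y) hw
    · rw [IsLocalRing.jacobson_eq_maximalIdeal _ bot_ne_top]
      exact le_maximalIdeal hy.ne_top
  rw [hbot] at hPp
  exact IsDomain.of_bot_isPrime R

theorem isLocalRing_quotient {R : Type u} [CommRing R] [IsLocalRing R] {I : Ideal R}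
    (hI : I ≤ maximalIdeal R) : IsLocalRing (R ⧸ I) :=
  have : Nontrivial (R ⧸ I) :=
    Ideal.Quotient.nontrivial_iff.2 fun h =>
      (maximalIdeal.isMaximal R).ne_top (top_le_iff.1 (h ▸ hI))
  IsLocalRing.of_surjective' (Ideal.Quotient.mk I) Ideal.Quotient.mk_surjective

theorem maximalIdeal_quotient {R : Type u} [CommRing R] [IsLocalRing R] {I : Ideal R}
    [IsLocalRing (R ⧸ I)] :
    maximalIdeal (R ⧸ I) = (maximalIdeal R).map (Ideal.Quotient.mk I) :=
  (IsLocalRing.map_maximalIdeal_of_surjective _ Ideal.Quotient.mk_surjective).symm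

/-- Induction through the quotient by one parameter shows that each parameter generates a prime. If
`R` were not a domain, all these primes would be minimal. The elements `a + b ^ (k + 1)` are all
parameters, so finiteness of the set of minimal primes makes two of the ideals equal, and then `b`
is a superfluous generator. The dimension is only bounded below, which is what passes to quotients.
-/
theorem isDomain_of_span_fin (n : ℕ) : ∀ (R : Type u) [CommRing R] [IsLocalRing R]
    [IsNoetherianRing R] (x : Fin n → R), Ideal.span (Set.range x) = maximalIdeal R →
    (n : WithBot ℕ∞) ≤ ringKrullDim R → IsDomain R := by
  induction n with
  | zero =>
    intro R _ _ _ x hx _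
    have h0 : maximalIdeal R = ⊥ := by
      rw [← hx, Set.range_eq_empty, Ideal.span_empty]
    exact ((IsLocalRing.isField_iff_maximalIdeal_eq).2 h0).isDomain
  | succ n ih =>
    intro R _ _ _ x hx hdim
    have hprime : ∀ y : R, ∀ z : Fin n → R,
        Ideal.span (insert y (Set.range z)) = maximalIdeal R → (Ideal.span {y}).IsPrime := by
      intro y z hyz
      have hle : Ideal.span {y} ≤ maximalIdeal R := by
        rw [← hyz]
        exact Ideal.span_mono (by simp)
      have hloc := isLocalRing_quotient hle
      rw [← Ideal.Quotient.isDomain_iff_prime]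
      refine ih _ (fun i => Ideal.Quotient.mk _ (z i)) ?_ ?_
      · rw [maximalIdeal_quotient, ← hyz, Ideal.map_span, Set.image_insert_eq,
          Ideal.Quotient.eq_zero_iff_mem.2 (Ideal.mem_span_singleton_self y),
          Ideal.span_insert_zero, ← Set.range_comp]
        rfl
      · have hd := ringKrullDim_le_ringKrullDim_quotient_add_card (R := R) {y}
          (by simpa [IsLocalRing.ringJacobson_eq_maximalIdeal] using
            (Ideal.span_singleton_le_iff_mem _).1 hle)
        rw [Finset.coe_singleton, Finset.card_singleton] at hd
        have := hdim.trans hd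
        push_cast at this
        exact ENat.WithBot.add_le_add_one_right_iff.1 this
    by_contra hnd
    have hx' : Ideal.span (insert (x 0) (Set.range (Fin.tail x))) = maximalIdeal R := by
      rw [← Fin.range_cons, Fin.cons_self_tail, hx]
    have hminimal : ∀ y : R, ∀ z : Fin n → R,
        Ideal.span (insert y (Set.range z)) = maximalIdeal R →
        Ideal.span {y} ∈ minimalPrimes R := fun y z hyz => by
      by_contra h
      exact hnd (isDomain_of_prime_span_singleton (hprime y z hyz) h)
    cases n with
    -- With a single parameter, `𝔪` itself would be a minimal prime, hence of height 0.
    | zero =>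
      have h := hminimal _ _ hx'
      have h0 : Ideal.span {x 0} = maximalIdeal R := by
        rw [← hx', Set.range_eq_empty]; simp
      rw [h0] at h
      have hh : (maximalIdeal R).height = 0 := by
        rw [Ideal.height_eq_zero_iff]; exact h
      rw [← IsLocalRing.maximalIdeal_height_eq_ringKrullDim, hh] at hdim
      have h1 : 0 + 1 ≤ 0 := by exact_mod_cast hdim
      omega
    | succ n =>
      set a := x 0
      set b := x 1
      set z : Fin n → R := Fin.tail (Fin.tail x)
      have hab : Ideal.span (insert a (insert b (Set.range z))) = maximalIdeal R := by
        rw [← hx', ← Fin.cons_self_tail (Fin.tail x), Fin.range_cons]; rfl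
      have hgen : ∀ k : ℕ, Ideal.span (insert (a + b ^ (k + 1)) (insert b (Set.range z))) =
          maximalIdeal R := by
        intro k
        rw [← hab]
        apply le_antisymm
        · rw [Ideal.span_le]
          rintro _ (rfl | h)
          · refine Ideal.add_mem _ (Ideal.subset_span (by simp)) ?_
            exact Ideal.pow_mem_of_mem _ (Ideal.subset_span (by simp)) _ (by simp)
          · exact Ideal.subset_span (Or.inr h)
        · rw [Ideal.span_le]
          rintro _ (rfl | h)
          · have h1 : a + b ^ (k + 1) ∈
                Ideal.span (insert (a + b ^ (k + 1)) (insert b (Set.range z))) :=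
              Ideal.subset_span (by simp)
            have h2 : b ^ (k + 1) ∈
                Ideal.span (insert (a + b ^ (k + 1)) (insert b (Set.range z))) :=
              Ideal.pow_mem_of_mem _ (Ideal.subset_span (by simp)) _ (by simp)
            simpa using Ideal.sub_mem _ h1 h2
          · exact Ideal.subset_span (Or.inr h)
      have hgen' : ∀ k : ℕ, Ideal.span (insert (a + b ^ (k + 1))
          (Set.range (Fin.cons b z : Fin (n + 1) → R))) = maximalIdeal R := by
        intro k; rw [Fin.range_cons]; exact hgen k
      have hmin := fun k => hminimal _ _ (hgen' k)
      have hfin := minimalPrimes.finite_of_isNoetherianRing R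
      obtain ⟨k, -, l, -, hkl, heq⟩ := Set.infinite_univ.exists_ne_map_eq_of_mapsTo
        (f := fun k : ℕ => Ideal.span {a + b ^ (k + 1)}) (fun k _ => hmin k) hfin
      wlog hlt : k < l generalizing k l
      · exact this l k hkl.symm heq.symm (lt_of_le_of_ne (not_lt.1 hlt) hkl.symm)
      have hP := hprime _ _ (hgen' k)
      have hbm : b ∈ maximalIdeal R := by rw [← hab]; exact Ideal.subset_span (by simp)
      have h1 : b ^ (k + 1) ∈ Ideal.span {a + b ^ (k + 1)} := by
        -- This is the difference of two generators of the same ideal, and `1 - b ^ (l - k)` is a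
        -- unit.
        have h3 : b ^ (k + 1) * (1 - b ^ (l - k)) ∈ Ideal.span {a + b ^ (k + 1)} := by
          have e : b ^ (k + 1) * (1 - b ^ (l - k)) = (a + b ^ (k + 1)) - (a + b ^ (l + 1)) := by
            rw [mul_sub, ← pow_add, show k + 1 + (l - k) = l + 1 by omega]; ring
          rw [e]
          refine Ideal.sub_mem _ (Ideal.mem_span_singleton_self _) ?_
          rw [heq]; exact Ideal.mem_span_singleton_self _
        have hu : IsUnit (1 - b ^ (l - k)) := by
          by_contra hu
          have hbl := Ideal.pow_mem_of_mem _ hbm (l - k) (by omega)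
          have := Ideal.add_mem _ ((mem_maximalIdeal _).2 hu) hbl
          rw [sub_add_cancel] at this
          exact (Ideal.ne_top_iff_one _).1 (maximalIdeal.isMaximal R).ne_top this
        exact (Ideal.mul_unit_mem_iff_mem _ hu).1 h3
      have hb : b ∈ Ideal.span {a + b ^ (k + 1)} := hP.mem_of_pow_mem _ h1
      -- Without `b` there remain `n + 1` generators of `𝔪`, too few for dimension at least `n + 2`.
      have hlast : Ideal.span (Set.range (Fin.cons (a + b ^ (k + 1)) z : Fin (n + 1) → R)) =
          maximalIdeal R := by
        rw [← hgen k, Fin.range_cons]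
        apply le_antisymm
        · exact Ideal.span_mono (Set.insert_subset_insert (Set.subset_insert _ _))
        · rw [Ideal.span_le]
          rintro _ (rfl | rfl | h)
          · exact Ideal.subset_span (by simp)
          · exact Ideal.span_mono (by simp) hb
          · exact Ideal.subset_span (Or.inr h)
      have := hdim.trans (ringKrullDim_le_card _ hlast)
      rw [Fintype.card_fin] at this
      have h' : n + 1 + 1 ≤ n + 1 := by exact_mod_cast this
      omega

theorem isDomain_of_span_card {R : Type u} [CommRing R] [IsLocalRing R]
    [IsNoetherianRing R] {ι : Type*} [Fintype ι] (x : ι → R)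
    (hx : Ideal.span (Set.range x) = maximalIdeal R)
    (hdim : (Fintype.card ι : WithBot ℕ∞) ≤ ringKrullDim R) : IsDomain R := by
  refine isDomain_of_span_fin _ R (x ∘ (Fintype.equivFin ι).symm) ?_ hdim
  rw [EquivLike.range_comp, hx]

/-- A part of a regular system of parameters generates a prime ideal, which contains none of the
other parameters. -/
theorem mem_span_image_of_mul_mem {R : Type u} [CommRing R] [IsLocalRing R]
    [IsNoetherianRing R] {n : ℕ} (hn : ringKrullDim R = n) {x : Fin n → R}
    (hx : Ideal.span (Set.range x) = maximalIdeal R) {T : Finset (Fin n)} {i : Fin n}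
    (hi : i ∉ T) {c : R} (hc : x i * c ∈ Ideal.span (x '' T)) : c ∈ Ideal.span (x '' T) := by
  classical
  have hxm : ∀ j, x j ∈ maximalIdeal R := fun j => hx ▸ Ideal.subset_span ⟨j, rfl⟩
  set J := Ideal.span (x '' T) with hJ
  have hle : J ≤ maximalIdeal R := by
    rw [hJ, ← hx]; exact Ideal.span_mono (Set.image_subset_range _ _)
  have hloc := isLocalRing_quotient hle
  -- The parameters outside `T` generate the maximal ideal of `R ⧸ J`, and their number is at most
  -- its dimension.
  have hdom : IsDomain (R ⧸ J) := by
    refine isDomain_of_span_card (ι := {j // j ∉ T}) (fun j => Ideal.Quotient.mk J (x j)) ?_ ?_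
    · rw [maximalIdeal_quotient, ← hx, Ideal.map_span]
      apply le_antisymm
      · refine Ideal.span_mono ?_
        rintro _ ⟨j, rfl⟩
        exact ⟨x j, ⟨j, rfl⟩, rfl⟩
      · rw [Ideal.span_le]
        rintro _ ⟨_, ⟨j, rfl⟩, rfl⟩
        by_cases hj : j ∈ T
        · rw [Ideal.Quotient.eq_zero_iff_mem.2 (show x j ∈ J from Ideal.subset_span ⟨j, hj, rfl⟩)]
          exact Ideal.zero_mem _
        · exact Ideal.subset_span ⟨⟨j, hj⟩, rfl⟩
    · have hd := ringKrullDim_le_ringKrullDim_quotient_add_card (R := R) (T.image x) (by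
        rw [IsLocalRing.ringJacobson_eq_maximalIdeal]
        intro y hy
        obtain ⟨j, -, rfl⟩ := Finset.mem_image.1 hy
        exact hxm j)
      rw [Finset.coe_image, ← hJ, hn] at hd
      have hcard : (n : WithBot ℕ∞) = (Fintype.card {j // j ∉ T} : ℕ) + (T.card : ℕ) := by
        have := T.card_le_univ
        rw [Fintype.card_fin] at this
        rw [Fintype.card_subtype_compl, Fintype.card_coe, ← Nat.cast_add, Fintype.card_fin,
          Nat.sub_add_cancel this]
      have h2 : (n : WithBot ℕ∞) ≤ ringKrullDim (R ⧸ J) + (T.card : ℕ) :=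
        hd.trans (by gcongr; exact Finset.card_image_le)
      rw [hcard] at h2
      exact ENat.WithBot.add_le_add_natCast_right_iff.1 h2
  have hprime := (Ideal.Quotient.isDomain_iff_prime J).1 hdom
  -- If `x i ∈ J`, then `n - 1` parameters already generate `𝔪`.
  refine (hprime.mem_or_mem hc).resolve_left fun hiJ => ?_
  have hspan : Ideal.span (Set.range fun j : {j // j ≠ i} => x j) = maximalIdeal R := by
    rw [← hx]
    apply le_antisymm
    · refine Ideal.span_mono ?_
      rintro _ ⟨j, rfl⟩
      exact ⟨j, rfl⟩
    · rw [Ideal.span_le]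
      rintro _ ⟨j, rfl⟩
      by_cases hj : j = i
      · subst hj
        refine Ideal.span_mono ?_ hiJ
        rintro _ ⟨l, hl, rfl⟩
        exact ⟨⟨l, fun h => hi (h ▸ hl)⟩, rfl⟩
      · exact Ideal.subset_span ⟨⟨j, hj⟩, rfl⟩
  have h := ringKrullDim_le_card _ hspan
  rw [hn] at h
  have hcard : Fintype.card {j // j ≠ i} = n - 1 := by simp
  rw [hcard] at h
  have h' : n ≤ n - 1 := by exact_mod_cast h
  have := i.pos
  omega

/-! ### Ideals generated by powers of the parameters. -/

/-- `I(a) = (x_j ^ a_j | j ∈ T)`. -/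
def powIdeal {R : Type u} [CommRing R] {n : ℕ} (x : Fin n → R) (T : Finset (Fin n))
    (a : Fin n → ℕ) : Ideal R :=
  Ideal.span ((fun j => x j ^ a j) '' (T : Set (Fin n)))

theorem mem_powIdeal_insert {R : Type u} [CommRing R] {n : ℕ} {x : Fin n → R}
    {T : Finset (Fin n)} {a : Fin n → ℕ} {j : Fin n} {c : R} :
    c ∈ powIdeal x (insert j T) a ↔ ∃ u, c - x j ^ a j * u ∈ powIdeal x T a := by
  rw [powIdeal, Finset.coe_insert, Set.image_insert_eq, Ideal.mem_span_insert]
  constructor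
  · rintro ⟨u, z, hz, rfl⟩
    refine ⟨u, ?_⟩
    rw [mul_comm, add_sub_cancel_left]; exact hz
  · rintro ⟨u, hu⟩
    exact ⟨u, _, hu, by ring⟩

theorem powIdeal_congr {R : Type u} [CommRing R] {n : ℕ} {x : Fin n → R}
    {T : Finset (Fin n)} {a b : Fin n → ℕ} (h : ∀ j ∈ T, a j = b j) :
    powIdeal x T a = powIdeal x T b := by
  unfold powIdeal
  congr 1
  exact Set.image_congr fun j hj => by rw [h j hj]

/-- Parameters are regular modulo powers of the other ones. -/
theorem mem_powIdeal_of_mul_mem {R : Type u} [CommRing R] {n : ℕ} {x : Fin n → R}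
    (hreg : ∀ (T : Finset (Fin n)) (i : Fin n), i ∉ T → ∀ c : R,
      x i * c ∈ Ideal.span (x '' T) → c ∈ Ideal.span (x '' T))
    (N : ℕ) : ∀ (T : Finset (Fin n)) (a : Fin n → ℕ), ∑ j ∈ T, a j = N → ∀ i ∉ T,
      ∀ c : R, x i * c ∈ powIdeal x T a → c ∈ powIdeal x T a := by
  induction N using Nat.strong_induction_on with
  | _ N ih =>
    intro T a hN i hi c hc
    by_cases h0 : ∃ j ∈ T, a j = 0
    · obtain ⟨j, hj, h0⟩ := h0
      have : (1 : R) ∈ powIdeal x T a := Ideal.subset_span ⟨j, hj, by simp [h0]⟩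
      rw [(Ideal.eq_top_iff_one _).2 this]; trivial
    by_cases h1 : ∀ j ∈ T, a j = 1
    · have : powIdeal x T a = Ideal.span (x '' T) := by
        rw [powIdeal_congr (b := fun _ => 1) h1, powIdeal]; simp
      rw [this] at hc ⊢
      exact hreg T i hi c hc
    push Not at h0 h1
    obtain ⟨j, hjT, hj1⟩ := h1
    have hj0 := h0 j hjT
    obtain ⟨t, ht⟩ : ∃ t, a j = t + 1 := ⟨a j - 1, by omega⟩
    have ht0 : t ≠ 0 := by omega
    obtain ⟨U, hjU, rfl⟩ : ∃ U, j ∉ U ∧ T = insert j U :=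
      ⟨T.erase j, Finset.notMem_erase _ _, (Finset.insert_erase hjT).symm⟩
    have hne : ∀ l ∈ U, l ≠ j := fun l hl h => hjU (h ▸ hl)
    have hi' : i ∉ U := fun h => hi (Finset.mem_insert_of_mem h)
    rw [Finset.sum_insert hjU] at hN
    have hupd : ∀ s, ∑ l ∈ insert j U, Function.update a j s l = s + ∑ l ∈ U, a l := by
      intro s
      rw [Finset.sum_insert hjU, Function.update_self]
      congr 1
      exact Finset.sum_congr rfl fun l hl => Function.update_of_ne (hne l hl) _ _
    have hU : ∀ s, powIdeal x U (Function.update a j s) = powIdeal x U a := fun s =>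
      powIdeal_congr fun l hl => Function.update_of_ne (hne l hl) _ _
    -- The induction hypothesis with the exponent of `x j` lowered to `s`, read modulo the remaining
    -- powers.
    have key : ∀ s, s < t + 1 → ∀ d, (∃ u, x i * d - x j ^ s * u ∈ powIdeal x U a) →
        ∃ u, d - x j ^ s * u ∈ powIdeal x U a := by
      intro s hs d hd
      have := ih (s + ∑ l ∈ U, a l) (by omega) (insert j U) (Function.update a j s)
        (hupd s) i hi d
      rw [mem_powIdeal_insert, mem_powIdeal_insert, hU, Function.update_self] at this
      exact this hd
    rw [mem_powIdeal_insert, ht] at hc ⊢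
    obtain ⟨u, hu⟩ := hc
    -- Modulo the powers indexed by `U`: `c ≡ x_j c'`, then `x_i c' ≡ x_j ^ t u` by cancelling
    -- `x_j`, then `c' ≡ x_j ^ t c''`. The cancellation uses the induction hypothesis with `j` as
    -- the distinguished index.
    obtain ⟨c', hc'⟩ := key 1 (by omega) c ⟨x j ^ t * u, by
      convert hu using 1; ring⟩
    have h2 : x j * (x i * c' - x j ^ t * u) ∈ powIdeal x U a := by
      have := Ideal.sub_mem _ hu (Ideal.mul_mem_left _ (x i) hc')
      convert this using 1; ring
    have h3 := ih (∑ l ∈ U, a l) (by omega) U a rfl j hjU _ h2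
    obtain ⟨c'', hc''⟩ := key t (by omega) c' ⟨u, h3⟩
    refine ⟨c'', ?_⟩
    have := Ideal.add_mem _ hc' (Ideal.mul_mem_left _ (x j) hc'')
    convert this using 1; ring

theorem mem_powIdeal_of_pow_mul_mem {R : Type u} [CommRing R] {n : ℕ} {x : Fin n → R}
    (hreg : ∀ (T : Finset (Fin n)) (i : Fin n), i ∉ T → ∀ c : R,
      x i * c ∈ Ideal.span (x '' T) → c ∈ Ideal.span (x '' T))
    {T : Finset (Fin n)} {a : Fin n → ℕ} {i : Fin n} (hi : i ∉ T) (k : ℕ) {c : R}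
    (hc : x i ^ k * c ∈ powIdeal x T a) : c ∈ powIdeal x T a := by
  induction k generalizing c with
  | zero => simpa using hc
  | succ k ih =>
    rw [pow_succ, mul_assoc] at hc
    exact mem_powIdeal_of_mul_mem hreg _ T a rfl i hi c (ih hc)

/-- The ideal `(x_1 ^ t, …, x_n ^ t)`. -/
abbrev powSpan {R : Type u} [CommRing R] {n : ℕ} (x : Fin n → R) (t : ℕ) : Ideal R :=
  Ideal.span (Set.range fun j => x j ^ t)

theorem powIdeal_univ {R : Type u} [CommRing R] {n : ℕ} (x : Fin n → R) (t : ℕ) :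
    powIdeal x Finset.univ (fun _ => t) = powSpan x t := by
  simp [powIdeal]

/-- The exponents drop from `t + k` to `t` one variable at a time: modulo the powers of the other
variables, the factor `x i ^ k` can be cancelled. Equivalently, the maps `R/(x_i ^ t) → R/(x_i ^ (t
+ k))` given by `(∏ x) ^ k` are injective. -/
theorem mem_powSpan_of_prod_pow_mul_mem {R : Type u} [CommRing R] {n : ℕ} {x : Fin n → R}
    (hreg : ∀ (T : Finset (Fin n)) (i : Fin n), i ∉ T → ∀ c : R,
      x i * c ∈ Ideal.span (x '' T) → c ∈ Ideal.span (x '' T))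
    {k t : ℕ} {c : R} (hc : (∏ i, x i) ^ k * c ∈ powSpan x (t + k)) : c ∈ powSpan x t := by
  classical
  rw [← powIdeal_univ] at hc ⊢
  -- `T` is the set of variables whose exponent is still `t + k`.
  have step : ∀ T : Finset (Fin n), (∏ i ∈ T, x i) ^ k * c ∈
      powIdeal x Finset.univ (fun i => if i ∈ T then t + k else t) →
      c ∈ powIdeal x Finset.univ (fun _ => t) := by
    intro T
    induction T using Finset.induction_on with
    | empty => simp
    | insert i T hi ih =>
      intro h
      refine ih ?_
      rw [Finset.prod_insert hi, mul_pow, mul_assoc] at h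
      set d := (∏ i ∈ T, x i) ^ k * c
      rw [← Finset.insert_erase (Finset.mem_univ i), mem_powIdeal_insert] at h ⊢
      obtain ⟨u, hu⟩ := h
      refine ⟨u, ?_⟩
      rw [powIdeal_congr (b := fun l => if l ∈ T then t + k else t)
        (fun l hl => by simp [Finset.ne_of_mem_erase hl])] at hu
      refine mem_powIdeal_of_pow_mul_mem hreg (Finset.notMem_erase i _) k ?_
      convert hu using 1
      simp [hi]
      ring
  exact step Finset.univ (by simpa using hc)

/-- The socle of `R / (x_1 ^ a_1, …, x_n ^ a_n)` is generated by `∏ x_i ^ (a_i - 1)`. -/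
theorem exists_mul_sub_prod_mem {R : Type u} [CommRing R] [IsLocalRing R] {n : ℕ} {x : Fin n → R}
    (hx : Ideal.span (Set.range x) = maximalIdeal R) (N : ℕ) : ∀ a : Fin n → ℕ,
      ∑ j, a j = N → ∀ c : R, c ∉ powIdeal x Finset.univ (fun j => a j + 1) →
      ∃ r, r * c - ∏ j, x j ^ a j ∈ powIdeal x Finset.univ (fun j => a j + 1) := by
  classical
  induction N using Nat.strong_induction_on with
  | _ N ih =>
    intro a hN c hc
    by_cases h0 : ∀ j, a j = 0
    · have e : powIdeal x Finset.univ (fun j => a j + 1) = maximalIdeal R := by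
        rw [← hx, powIdeal_congr (b := fun _ => 1) (by simp [h0]), powIdeal]; simp
      rw [e] at hc
      obtain ⟨u, rfl⟩ := not_not.1 (fun h => hc ((mem_maximalIdeal _).2 h))
      refine ⟨(u⁻¹ : Rˣ), ?_⟩
      simp [h0]
    push Not at h0
    obtain ⟨i, hi⟩ := h0
    obtain ⟨t, ht⟩ : ∃ t, a i = t + 1 := ⟨a i - 1, by omega⟩
    have hprod : ∀ s, ∏ j, x j ^ (Function.update a i s j) =
        x i ^ s * ∏ j ∈ Finset.univ.erase i, x j ^ a j := by
      intro s
      rw [← Finset.mul_prod_erase _ _ (Finset.mem_univ i), Function.update_self]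
      congr 1
      exact Finset.prod_congr rfl fun j hj => by
        rw [Function.update_of_ne (Finset.ne_of_mem_erase hj)]
    have hsum : ∀ s, ∑ j, Function.update a i s j =
        s + ∑ j ∈ Finset.univ.erase i, a j := by
      intro s
      rw [← Finset.add_sum_erase _ _ (Finset.mem_univ i), Function.update_self]
      congr 1
      exact Finset.sum_congr rfl fun j hj => by
        rw [Function.update_of_ne (Finset.ne_of_mem_erase hj)]
    have haa : a = Function.update a i (t + 1) := by rw [← ht, Function.update_eq_self]
    set I := powIdeal x (Finset.univ.erase i) (fun j => a j + 1)
    have hmem : ∀ s d, d ∈ powIdeal x Finset.univ (fun j => Function.update a i s j + 1) ↔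
        ∃ u, d - x i ^ (s + 1) * u ∈ I := by
      intro s d
      rw [← Finset.insert_erase (Finset.mem_univ i), mem_powIdeal_insert, Function.update_self,
        powIdeal_congr (b := fun j => a j + 1) fun j hj => by
          rw [Function.update_of_ne (Finset.ne_of_mem_erase hj)]]
    have hNN : t + 1 + ∑ j ∈ Finset.univ.erase i, a j = N := by
      rw [← hsum, ← haa, hN]
    rw [haa] at hc ⊢
    rw [hmem] at hc
    -- The induction hypothesis is applied with exponent `s` at `i`; multiplying by `x i ^ s'`
    -- brings the exponent back to `t + 1`.
    have key : ∀ s s' c', s + s' = t + 1 → 0 < s' → ¬ (∃ u, c' - x i ^ (s + 1) * u ∈ I) →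
        ∃ r u, x i ^ s' * (r * c') - ∏ j, x j ^ (Function.update a i (t + 1) j) -
          x i ^ (t + 1 + 1) * u ∈ I := by
      intro s s' c' hs hs' hc'
      obtain ⟨r, hr⟩ := ih (s + ∑ j ∈ Finset.univ.erase i, a j) (by omega)
        (Function.update a i s) (hsum s) c' (by rwa [hmem])
      obtain ⟨u, hu⟩ := (hmem _ _).1 hr
      refine ⟨r, u, ?_⟩
      have := Ideal.mul_mem_left _ (x i ^ s') hu
      rw [hprod] at this
      rw [hprod]
      convert this using 1
      rw [← hs]
      ring
    -- Either `c ≡ x_i ^ (t + 1) c'` with `c'` nonzero modulo `x_i` and the other powers, or `c` is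
    -- already nonzero for the smaller exponent and one factor `x_i` suffices.
    by_cases hcase : ∃ u, c - x i ^ (t + 1) * u ∈ I
    · obtain ⟨c', hc'⟩ := hcase
      obtain ⟨r, u, hu⟩ := key 0 (t + 1) c' (by omega) (by omega) (by
        rintro ⟨v, hv⟩
        refine hc ⟨v, ?_⟩
        have := Ideal.add_mem _ hc' (Ideal.mul_mem_left _ (x i ^ (t + 1)) hv)
        convert this using 1; ring)
      refine ⟨r, (hmem _ _).2 ⟨u, ?_⟩⟩
      have := Ideal.add_mem _ hu (Ideal.mul_mem_left _ r hc')
      convert this using 1; ring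
    · obtain ⟨r, u, hu⟩ := key t 1 c (by omega) (by omega) hcase
      refine ⟨x i * r, (hmem _ _).2 ⟨u, ?_⟩⟩
      convert hu using 1; ring

theorem exists_mul_sub_prod_pow_mem_powSpan {R : Type u} [CommRing R] [IsLocalRing R] {n : ℕ}
    {x : Fin n → R} (hx : Ideal.span (Set.range x) = maximalIdeal R) {t : ℕ} {c : R}
    (hc : c ∉ powSpan x (t + 1)) : ∃ r, r * c - (∏ j, x j) ^ t ∈ powSpan x (t + 1) := by
  rw [← powIdeal_univ] at hc ⊢
  rw [← Finset.prod_pow]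
  exact exists_mul_sub_prod_mem hx _ (fun _ => t) rfl c hc

/-! ### The Čech complex -/

/-! ### Arithmetic in the localizations, by clearing denominators. -/

section CechLoc

variable {R : Type u} [CommRing R] {S : Type v} [CommRing S] [Algebra R S] {r : ℕ} {x : Fin r → R}
  {s t : Finset (Fin r)}

theorem CechLoc.isUnit (s : Finset (Fin r)) :
    IsUnit (algebraMap R (CechLoc S x s) (∏ i ∈ s, x i)) := by
  have h : IsUnit (algebraMap S (CechLoc S x s) (algebraMap R S (∏ i ∈ s, x i))) :=
    IsLocalization.Away.algebraMap_isUnit (algebraMap R S (∏ i ∈ s, x i))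
  rwa [← IsScalarTower.algebraMap_apply R S (CechLoc S x s)] at h

theorem CechLoc.smul_cancel {c : R} {s : Finset (Fin r)} {N : ℕ} (hc : c ∣ (∏ i ∈ s, x i) ^ N)
    {a b : CechLoc S x s} (h : c • a = c • b) : a = b := by
  have hu : IsUnit (algebraMap R (CechLoc S x s) c) :=
    isUnit_of_dvd_unit (map_dvd _ hc) (by rw [map_pow]; exact (CechLoc.isUnit s).pow N)
  rw [Algebra.smul_def, Algebra.smul_def] at h
  exact hu.mul_left_cancel h

theorem CechLoc.exists_smul_eq (a : CechLoc S x s) :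
    ∃ (N : ℕ) (b : S), (∏ i ∈ s, x i) ^ N • a = algebraMap S (CechLoc S x s) b := by
  obtain ⟨⟨b, ⟨_, N, rfl⟩⟩, h⟩ :=
    IsLocalization.surj (Submonoid.powers (algebraMap R S (∏ i ∈ s, x i))) a
  have e : algebraMap S (CechLoc S x s) (algebraMap R S (∏ i ∈ s, x i) ^ N) =
      algebraMap R (CechLoc S x s) (∏ i ∈ s, x i) ^ N := by
    rw [map_pow, ← IsScalarTower.algebraMap_apply R S (CechLoc S x s)]
  refine ⟨N, b, ?_⟩
  rw [Algebra.smul_def, map_pow, ← e, mul_comm]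
  exact h

theorem CechLoc.exists_eq_smul (s : Finset (Fin r)) (N : ℕ) (b : S) :
    ∃ a : CechLoc S x s, (∏ i ∈ s, x i) ^ N • a = algebraMap S (CechLoc S x s) b := by
  obtain ⟨u, hu⟩ := (CechLoc.isUnit (S := S) (x := x) s).pow N
  refine ⟨↑u⁻¹ * algebraMap S _ b, ?_⟩
  rw [Algebra.smul_def, map_pow, ← hu, ← mul_assoc, Units.mul_inv, one_mul]

theorem CechLoc.exists_smul_eq_zero {b : S} (h : algebraMap S (CechLoc S x s) b = 0) :
    ∃ N : ℕ, (∏ i ∈ s, x i) ^ N • b = 0 := by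
  obtain ⟨⟨_, N, rfl⟩, h⟩ :=
    (IsLocalization.map_eq_zero_iff (Submonoid.powers (algebraMap R S (∏ i ∈ s, x i))) _ b).1 h
  refine ⟨N, ?_⟩
  rw [Algebra.smul_def, map_pow]
  exact h

theorem CechLoc.algebraMap_smul (c : R) (b : S) :
    algebraMap S (CechLoc S x s) (c • b) = c • algebraMap S (CechLoc S x s) b := by
  rw [Algebra.smul_def, Algebra.smul_def, map_mul, ← IsScalarTower.algebraMap_apply]

theorem CechLoc.eq_zero_of_smul_eq_zero {y : R} (hy : ∀ c : S, y • c = 0 → c = 0)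
    {a : CechLoc S x s} (h : y • a = 0) : a = 0 := by
  obtain ⟨N, b, hb⟩ := CechLoc.exists_smul_eq a
  have h1 : algebraMap S (CechLoc S x s) (y • b) = 0 := by
    rw [CechLoc.algebraMap_smul, ← hb, smul_comm, h, smul_zero]
  obtain ⟨M, hM⟩ := CechLoc.exists_smul_eq_zero h1
  rw [smul_comm] at hM
  have h2 := hy _ hM
  refine CechLoc.smul_cancel (c := (∏ i ∈ s, x i) ^ (M + N)) dvd_rfl ?_
  rw [smul_zero, pow_add, mul_smul, hb, ← CechLoc.algebraMap_smul, h2, map_zero]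

theorem cechRes_smul (h : s ⊆ t) (c : R) (a : CechLoc S x s) :
    cechRes S x h (c • a) = c • cechRes S x h a :=
  ((cechRes S x h).toLinearMap.restrictScalars R).map_smul c a

theorem cechRes_algebraMap (h : s ⊆ t) (b : S) :
    cechRes S x h (algebraMap S _ b) = algebraMap S _ b :=
  (cechRes S x h).commutes b

theorem pow_smul_eq_zero {y : R} (hy : ∀ c : S, y • c = 0 → c = 0) (N : ℕ) {c : S}
    (h : y ^ N • c = 0) : c = 0 := by
  induction N with
  | zero => simpa using h
  | succ N ih =>
    rw [pow_succ', mul_smul] at h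
    exact ih (hy _ h)

/-- A numerator killed by a power of `x_i ∏_s x` is already killed by a power of `∏_s x`, since `x
i` is a nonzerodivisor on `S`. -/
theorem cechRes_eq_zero {i : Fin r} (hi : ∀ c : S, x i • c = 0 → c = 0) (his : i ∉ s)
    (h : s ⊆ t) (ht : t = insert i s) {a : CechLoc S x s} (h0 : cechRes S x h a = 0) : a = 0 := by
  obtain ⟨N, b, hb⟩ := CechLoc.exists_smul_eq a
  have h1 : algebraMap S (CechLoc S x t) b = 0 := by
    rw [← cechRes_algebraMap h, ← hb, cechRes_smul, h0, smul_zero]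
  obtain ⟨M, hM⟩ := CechLoc.exists_smul_eq_zero h1
  rw [ht, Finset.prod_insert his, mul_pow, mul_smul] at hM
  have h2 := pow_smul_eq_zero hi M hM
  refine CechLoc.smul_cancel (c := (∏ i ∈ s, x i) ^ (M + N)) dvd_rfl ?_
  rw [smul_zero, pow_add, mul_smul, hb, ← CechLoc.algebraMap_smul, h2, map_zero]

theorem exists_cechRes_eq {i : Fin r} (his : i ∉ s) (h : s ⊆ t) (ht : t = insert i s)
    (a : CechLoc S x t) : ∃ (N : ℕ) (b : CechLoc S x s), cechRes S x h b = x i ^ N • a := by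
  obtain ⟨N, c, hc⟩ := CechLoc.exists_smul_eq a
  obtain ⟨b, hb⟩ := CechLoc.exists_eq_smul (x := x) s N c
  refine ⟨N, b, CechLoc.smul_cancel (c := (∏ i ∈ s, x i) ^ N) (N := N) ?_ ?_⟩
  · exact pow_dvd_pow_of_dvd (Finset.prod_dvd_prod_of_subset _ _ _ h) N
  · have hP : ∏ i ∈ t, x i = x i * ∏ i ∈ s, x i := by rw [ht, Finset.prod_insert his]
    rw [← cechRes_smul, hb, cechRes_algebraMap, ← hc, ← mul_smul, ← mul_pow, mul_comm, ← hP]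

end CechLoc

/-! ### Čech complexes of quotients of the coefficient ring. -/

section Functoriality

variable {R : Type u} [CommRing R] {S S' : Type v} [CommRing S] [Algebra R S] [CommRing S']
  [Algebra R S'] {r : ℕ} (x : Fin r → R) {s t : Finset (Fin r)}

/-- The map of localizations `S_{x_s} → S'_{x_s}` induced by `φ : S → S'`. -/
def cechLocMap (φ : S →ₐ[R] S') (s : Finset (Fin r)) : CechLoc S x s →ₐ[R] CechLoc S' x s :=
  IsLocalization.liftAlgHom (M := Submonoid.powers (algebraMap R S (∏ i ∈ s, x i)))
    (f := (IsScalarTower.toAlgHom R S' (CechLoc S' x s)).comp φ) (by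
      rintro ⟨_, n, rfl⟩
      rw [AlgHom.comp_apply]
      change IsUnit (algebraMap S' _ (φ (algebraMap R S (∏ i ∈ s, x i) ^ n)))
      rw [map_pow, AlgHom.commutes, map_pow, ← IsScalarTower.algebraMap_apply]
      exact (CechLoc.isUnit s).pow n)

theorem cechLocMap_algebraMap (φ : S →ₐ[R] S') (b : S) :
    cechLocMap x φ s (algebraMap S _ b) = algebraMap S' _ (φ b) := by
  simp [cechLocMap]

theorem cechLocMap_cechRes (φ : S →ₐ[R] S') (h : s ⊆ t) (a : CechLoc S x s) :
    cechLocMap x φ t (cechRes S x h a) = cechRes S' x h (cechLocMap x φ s a) := by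
  obtain ⟨N, b, hb⟩ := CechLoc.exists_smul_eq a
  refine CechLoc.smul_cancel (c := (∏ i ∈ s, x i) ^ N) (N := N) ?_ ?_
  · exact pow_dvd_pow_of_dvd (Finset.prod_dvd_prod_of_subset _ _ _ h) N
  · rw [← map_smul, ← cechRes_smul, ← cechRes_smul, ← map_smul, hb, cechRes_algebraMap,
      cechLocMap_algebraMap, cechLocMap_algebraMap, cechRes_algebraMap]

theorem cechLocMap_surjective {φ : S →ₐ[R] S'} (hφ : Function.Surjective φ)
    (s : Finset (Fin r)) : Function.Surjective (cechLocMap x φ s) := by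
  intro a
  obtain ⟨N, b, hb⟩ := CechLoc.exists_smul_eq a
  obtain ⟨b, rfl⟩ := hφ b
  obtain ⟨c, hc⟩ := CechLoc.exists_eq_smul (x := x) s N b
  refine ⟨c, CechLoc.smul_cancel (c := (∏ i ∈ s, x i) ^ N) dvd_rfl ?_⟩
  rw [← map_smul, hc, cechLocMap_algebraMap, hb]

/-- Exactness of localization: after clearing denominators the numerator lies in `ker φ`, hence is a
multiple of `y`, and division by powers of `∏_s x` keeps that factor. -/
theorem exists_smul_eq_of_cechLocMap_eq_zero {φ : S →ₐ[R] S'} {y : R}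
    (hy : ∀ c : S, φ c = 0 → ∃ d, c = y • d) {a : CechLoc S x s}
    (ha : cechLocMap x φ s a = 0) : ∃ b, a = y • b := by
  obtain ⟨N, c, hc⟩ := CechLoc.exists_smul_eq a
  have h1 : algebraMap S' (CechLoc S' x s) (φ c) = 0 := by
    rw [← cechLocMap_algebraMap, ← hc, map_smul, ha, smul_zero]
  obtain ⟨M, hM⟩ := CechLoc.exists_smul_eq_zero h1
  rw [← map_smul] at hM
  obtain ⟨d, hd⟩ := hy _ hM
  obtain ⟨b, hb⟩ := CechLoc.exists_eq_smul (x := x) s (M + N) d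
  refine ⟨b, CechLoc.smul_cancel (c := (∏ i ∈ s, x i) ^ (M + N)) dvd_rfl ?_⟩
  rw [smul_comm _ y, hb, pow_add, mul_smul, hc, ← CechLoc.algebraMap_smul,
    ← CechLoc.algebraMap_smul, hd]

/-- The map of Čech cochains induced by `φ : S → S'`. -/
def cechMap (φ : S →ₐ[R] S') (k : ℕ) : CechCochain S x k →ₗ[R] CechCochain S' x k :=
  LinearMap.pi fun s => (cechLocMap x φ s.1).toLinearMap ∘ₗ
    LinearMap.proj (φ := fun s : {s : Finset (Fin r) // s.card = k} => CechLoc S x s.1) s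

theorem cechMap_apply (φ : S →ₐ[R] S') (k : ℕ) (a : CechCochain S x k)
    (s : {s : Finset (Fin r) // s.card = k}) : cechMap x φ k a s = cechLocMap x φ s.1 (a s) :=
  rfl

theorem cechD_cechMap (φ : S →ₐ[R] S') (k : ℕ) (a : CechCochain S x k) :
    cechD S' x k (cechMap x φ k a) = cechMap x φ (k + 1) (cechD S x k a) := by
  funext t
  rw [cechMap_apply, cechD_apply, cechD_apply, map_sum]
  refine Finset.sum_congr rfl fun j _ => ?_
  rw [map_smul, cechLocMap_cechRes, cechMap_apply]

theorem cechMap_surjective {φ : S →ₐ[R] S'} (hφ : Function.Surjective φ) (k : ℕ) :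
    Function.Surjective (cechMap x φ k) := by
  intro a
  have h (s : {s : Finset (Fin r) // s.card = k}) : ∃ b, cechLocMap x φ s.1 b = a s :=
    cechLocMap_surjective x hφ s.1 (a s)
  choose b hb using h
  exact ⟨b, funext hb⟩

theorem exists_smul_eq_of_cechMap_eq_zero {φ : S →ₐ[R] S'} {y : R}
    (hy : ∀ c : S, φ c = 0 → ∃ d, c = y • d) {k : ℕ} {a : CechCochain S x k}
    (ha : cechMap x φ k a = 0) : ∃ b, a = y • b := by
  have h (s : {s : Finset (Fin r) // s.card = k}) : ∃ b, a s = y • b :=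
    exists_smul_eq_of_cechLocMap_eq_zero x hy (congrFun ha s)
  choose b hb using h
  exact ⟨b, funext hb⟩

theorem cechMap_smul_eq_zero {φ : S →ₐ[R] S'} {y : R} (hy : ∀ c : S', y • c = 0) (k : ℕ)
    (a : CechCochain S x k) : cechMap x φ k (y • a) = 0 := by
  rw [map_smul]
  funext s
  obtain ⟨N, c, hc⟩ := CechLoc.exists_smul_eq (cechMap x φ k a s)
  refine CechLoc.smul_cancel (c := (∏ i ∈ s.1, x i) ^ N) dvd_rfl ?_
  rw [Pi.smul_apply, smul_comm, hc, ← CechLoc.algebraMap_smul, hy, map_zero, Pi.zero_apply,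
    smul_zero]

theorem cechMap_mem_cechB (φ : S →ₐ[R] S') {k : ℕ} {a : CechCochain S x k}
    (ha : a ∈ cechB S x k) : cechMap x φ k a ∈ cechB S' x k := by
  cases k with
  | zero =>
    have h : a = 0 := ha
    rw [h, map_zero]
    exact Submodule.zero_mem _
  | succ k =>
    obtain ⟨b, rfl⟩ := ha
    exact ⟨cechMap x φ k b, cechD_cechMap x φ k b⟩

/-- A coboundary lifts to a coboundary. -/
theorem exists_cechB_of_cechMap_mem_cechB {φ : S →ₐ[R] S'} (hφ : Function.Surjective φ) {y : R}
    (hy : ∀ c : S, φ c = 0 → ∃ d, c = y • d) {k : ℕ} {a : CechCochain S x k}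
    (ha : cechMap x φ k a ∈ cechB S' x k) : ∃ e ∈ cechB S x k, ∃ c, a = e + y • c := by
  cases k with
  | zero =>
    obtain ⟨c, hc⟩ := exists_smul_eq_of_cechMap_eq_zero x hy (show cechMap x φ 0 a = 0 from ha)
    exact ⟨0, Submodule.zero_mem _, c, by rw [zero_add, hc]⟩
  | succ k =>
    obtain ⟨v, hv⟩ := ha
    obtain ⟨v, rfl⟩ := cechMap_surjective x hφ k v
    rw [cechD_cechMap] at hv
    obtain ⟨c, hc⟩ := exists_smul_eq_of_cechMap_eq_zero x hy (a := a - cechD S x k v)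
      (by rw [map_sub, hv, sub_self])
    exact ⟨_, ⟨v, rfl⟩, c, by rw [← hc, add_sub_cancel]⟩

end Functoriality

/-! ### Vanishing of the cohomology below the top degree. -/

section Vanishing

variable {R : Type u} [CommRing R] {S : Type v} [CommRing S] [Algebra R S] {r : ℕ} {x : Fin r → R}

theorem cechCochain_smul_cancel {y : R} (hy : ∀ c : S, y • c = 0 → c = 0) {k : ℕ}
    {a b : CechCochain S x k} (h : y • a = y • b) : a = b := by
  rw [← sub_eq_zero] at h ⊢
  rw [← smul_sub] at h
  funext s
  exact CechLoc.eq_zero_of_smul_eq_zero hy (congrFun h s)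

/-- Every face `t \ {j}` with `j ≠ i` still contains `i`, so only the term of `j = i` survives. -/
theorem cechD_apply_of_mem {k : ℕ} {a : CechCochain S x k} {i : Fin r}
    (ha : ∀ s, i ∈ s.1 → a s = 0) (t : {s : Finset (Fin r) // s.card = k + 1}) (hi : i ∈ t.1) :
    cechD S x k a t = (-1 : R) ^ below t.1 i • cechRes S x (Finset.erase_subset i t.1)
      (a ⟨t.1.erase i, by rw [Finset.card_erase_of_mem hi, t.2, Nat.add_sub_cancel]⟩) := by
  rw [cechD_apply]
  refine Finset.sum_eq_single (⟨i, hi⟩ : {j // j ∈ t.1}) ?_ (by simp)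
  intro j _ hj
  rw [ha _ (Finset.mem_erase.2 ⟨fun h => hj (Subtype.ext h.symm), hi⟩), map_zero, smul_zero]

theorem neg_one_pow_smul_smul {M : Type*} [AddCommGroup M] [Module R M] (N : ℕ) (m : M) :
    (-1 : R) ^ N • (-1 : R) ^ N • m = m := by
  rw [← mul_smul, ← mul_pow]; simp

/-- A cocycle supported on the faces that do not contain a regular parameter is zero. -/
theorem cech_eq_zero_of_mem_cechZ {i : Fin r} (hi : ∀ c : S, x i • c = 0 → c = 0) {k : ℕ}
    {a : CechCochain S x k} (ha : a ∈ cechZ S x k) (h0 : ∀ s, i ∈ s.1 → a s = 0) : a = 0 := by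
  funext s
  by_cases his : i ∈ s.1
  · exact h0 s his
  -- The cocycle condition on the face `s ∪ {i}` says that `± a_s` restricts to zero there, and that
  -- restriction is injective.
  have h1 := cechD_apply_of_mem h0 ⟨insert i s.1, by rw [Finset.card_insert_of_notMem his, s.2]⟩
    (Finset.mem_insert_self _ _)
  rw [show cechD S x k a = 0 from ha] at h1
  have h2 := congrArg (fun m => (-1 : R) ^ below (insert i s.1) i • m) h1
  simp only [neg_one_pow_smul_smul, Pi.zero_apply, smul_zero] at h2
  have hs : (⟨(insert i s.1).erase i, by rw [Finset.erase_insert his, s.2]⟩ :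
      {s : Finset (Fin r) // s.card = k}) = s := Subtype.ext (Finset.erase_insert his)
  have h3 : ∀ (s' : {s : Finset (Fin r) // s.card = k}) (h : s'.1 ⊆ insert i s.1), s' = s →
      cechRes S x h (a s') = 0 → a s = 0 := by
    rintro s' h rfl h'
    exact cechRes_eq_zero hi his h rfl h'
  exact h3 _ _ hs h2.symm

/-- The cohomology of the Čech complex is torsion with respect to each parameter. -/
theorem exists_pow_smul_mem_cechB {i : Fin r} (hi : ∀ c : S, x i • c = 0 → c = 0) {k : ℕ}
    {a : CechCochain S x k} (ha : a ∈ cechZ S x k) : ∃ N : ℕ, x i ^ N • a ∈ cechB S x k := by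
  cases k with
  | zero =>
    refine ⟨0, ?_⟩
    rw [cech_eq_zero_of_mem_cechZ hi ha, smul_zero]
    · exact Submodule.zero_mem _
    · intro s hs
      rw [Finset.card_eq_zero.1 s.2] at hs
      simp at hs
  | succ k =>
    classical
    have hex : ∀ s : {s : Finset (Fin r) // s.card = k}, ∃ N : ℕ, ∀ his : i ∉ s.1,
        ∃ b : CechLoc S x s.1, cechRes S x (Finset.subset_insert i s.1) b =
          x i ^ N • a ⟨insert i s.1, by rw [Finset.card_insert_of_notMem his, s.2]⟩ := by
      intro s
      by_cases his : i ∈ s.1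
      · exact ⟨0, fun h => absurd his h⟩
      · obtain ⟨N, b, hb⟩ := exists_cechRes_eq his (Finset.subset_insert i s.1) rfl
          (a ⟨insert i s.1, by rw [Finset.card_insert_of_notMem his, s.2]⟩)
        exact ⟨N, fun _ => ⟨b, hb⟩⟩
    choose N hN using hex
    have hsup : ∀ s, N s ≤ Finset.univ.sup N := fun s => Finset.le_sup (Finset.mem_univ s)
    set M := Finset.univ.sup N
    -- Contracting homotopy: `b_s = ± x_i ^ M a_(s ∪ i)` for `i ∉ s`, and zero otherwise. The finite
    -- supremum `M` makes the exponent uniform over the faces.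
    have hb' : ∀ s : {s : Finset (Fin r) // s.card = k}, ∃ b : CechLoc S x s.1,
        (i ∈ s.1 → b = 0) ∧ ∀ his : i ∉ s.1, cechRes S x (Finset.subset_insert i s.1) b =
          (-1 : R) ^ below (insert i s.1) i • x i ^ M •
            a ⟨insert i s.1, by rw [Finset.card_insert_of_notMem his, s.2]⟩ := by
      intro s
      by_cases his : i ∈ s.1
      · exact ⟨0, fun _ => rfl, fun h => absurd his h⟩
      · obtain ⟨b, hb⟩ := hN s his
        refine ⟨(-1 : R) ^ below (insert i s.1) i • x i ^ (M - N s) • b,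
          fun h => absurd h his, fun _ => ?_⟩
        rw [cechRes_smul, cechRes_smul, hb, ← mul_smul (x i ^ _), ← pow_add,
          Nat.sub_add_cancel (hsup s)]
    choose b hb0 hb using hb'
    refine ⟨M, b, ?_⟩
    symm
    rw [← sub_eq_zero]
    -- The difference `x_i ^ M a - d b` is a cocycle that vanishes on all faces containing `i`.
    refine cech_eq_zero_of_mem_cechZ hi ?_ ?_
    · exact Submodule.sub_mem _ (Submodule.smul_mem _ _ ha) (cechD_cechD S x k b)
    · intro t hit
      rw [Pi.sub_apply, Pi.smul_apply, cechD_apply_of_mem hb0 t hit, sub_eq_zero]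
      have key : ∀ (s' : {s : Finset (Fin r) // s.card = k}) (h : s'.1 ⊆ t.1), i ∉ s'.1 →
          insert i s'.1 = t.1 →
          cechRes S x h (b s') = (-1 : R) ^ below t.1 i • x i ^ M • a t := by
        obtain ⟨t, ht⟩ := t
        rintro s' h his' rfl
        exact hb s' his'
      rw [key ⟨t.1.erase i, by rw [Finset.card_erase_of_mem hit, t.2, Nat.add_sub_cancel]⟩
        (Finset.erase_subset i t.1) (Finset.notMem_erase _ _) (Finset.insert_erase hit), neg_one_pow_smul_smul]

/-- If `y` is regular on `S` and the cohomology of `S / y` vanishes in the degree below, then `y`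
is regular on the cohomology of `S`. -/
theorem mem_cechB_of_smul_mem_cechB {S' : Type v} [CommRing S'] [Algebra R S'] {φ : S →ₐ[R] S'}
    (hφ : Function.Surjective φ) {y : R} (hy : ∀ c : S, φ c = 0 → ∃ d, c = y • d)
    (hy' : ∀ c : S', y • c = 0) (hreg : ∀ c : S, y • c = 0 → c = 0) {k : ℕ}
    (hvan : ∀ l, l + 1 = k → cechZ S' x l ≤ cechB S' x l)
    {a : CechCochain S x k} (h : y • a ∈ cechB S x k) : a ∈ cechB S x k := by
  cases k with
  | zero =>
    have h0 : a = 0 := cechCochain_smul_cancel hreg (h.trans (smul_zero y).symm)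
    rw [h0]; exact Submodule.zero_mem _
  | succ k =>
    -- From `y a = d b`, the image of `b` in the complex of `S'` is a cocycle, hence a coboundary.
    -- So `b = e + y c` with `d e = 0`, and `y a = y d c`.
    obtain ⟨b, hb⟩ := h
    have h1 : cechMap x φ k b ∈ cechZ S' x k := by
      change cechD S' x k _ = 0
      rw [cechD_cechMap, hb, cechMap_smul_eq_zero x hy']
    obtain ⟨e, he, c, rfl⟩ := exists_cechB_of_cechMap_mem_cechB x hφ hy (hvan k rfl h1)
    refine ⟨c, cechCochain_smul_cancel hreg ?_⟩
    rw [← hb, map_add, map_smul, show cechD S x k e = 0 from cechB_le_cechZ S x k he, zero_add]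

/-- The Čech complex of a regular sequence is exact below the top degree. -/
theorem cechZ_le_cechB
    (hreg : ∀ (T : Finset (Fin r)) (i : Fin r), i ∉ T → ∀ c : R,
      x i * c ∈ Ideal.span (x '' T) → c ∈ Ideal.span (x '' T)) (m : ℕ) :
    ∀ (T : Finset (Fin r)) (S : Type v) [CommRing S] [Algebra R S],
      Function.Surjective (algebraMap R S) →
      (∀ c, algebraMap R S c = 0 ↔ c ∈ Ideal.span (x '' T)) →
      T.card + m = r → ∀ k < m, cechZ S x k ≤ cechB S x k := by
  induction m with
  | zero => intro _ _ _ _ _ _ _ k hk; omega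
  -- `S` is `R/(x_j | j ∈ T)`, described by a surjection and its kernel so that a further quotient
  -- by `x i` has the same shape.
  | succ m ih =>
    intro T S _ _ hsurj hker hT k hk a ha
    obtain ⟨i, hi⟩ : ∃ i, i ∉ T := by
      by_contra! h
      rw [Finset.eq_univ_iff_forall.2 h, Finset.card_univ, Fintype.card_fin] at hT
      omega
    have hregi : ∀ c : S, x i • c = 0 → c = 0 := by
      intro c hc
      obtain ⟨c, rfl⟩ := hsurj c
      rw [Algebra.smul_def, ← map_mul, hker] at hc
      exact (hker c).2 (hreg T i hi c hc)
    let J : Ideal S := Ideal.span {algebraMap R S (x i)}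
    let φ : S →ₐ[R] S ⧸ J := Ideal.Quotient.mkₐ R J
    have hφ : Function.Surjective φ := Ideal.Quotient.mkₐ_surjective R J
    have hy : ∀ c : S, φ c = 0 → ∃ d, c = x i • d := by
      intro c hc
      obtain ⟨d, rfl⟩ := Ideal.mem_span_singleton'.1 (Ideal.Quotient.eq_zero_iff_mem.1 hc)
      exact ⟨d, by rw [Algebra.smul_def, mul_comm]⟩
    have hy1 : algebraMap R (S ⧸ J) (x i) = 0 :=
      Ideal.Quotient.eq_zero_iff_mem.2 (Ideal.mem_span_singleton_self (algebraMap R S (x i)))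
    have hy' : ∀ c : S ⧸ J, x i • c = 0 := fun c => by rw [Algebra.smul_def, hy1, zero_mul]
    have hvan := ih (insert i T) (S ⧸ J) (Ideal.Quotient.mk_surjective.comp hsurj) (by
      intro c
      rw [Finset.coe_insert, Set.image_insert_eq, Ideal.mem_span_insert]
      constructor
      · intro hc
        obtain ⟨d, hd⟩ := hy (algebraMap R S c) hc
        obtain ⟨d, rfl⟩ := hsurj d
        refine ⟨d, c - d * x i, (hker _).1 ?_, by ring⟩
        rw [map_sub, hd, Algebra.smul_def, map_mul, mul_comm, sub_self]
      · rintro ⟨d, z, hz, rfl⟩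
        rw [map_add, map_mul, hy1, mul_zero, zero_add, IsScalarTower.algebraMap_apply R S,
          (hker z).2 hz, map_zero])
      (by rw [Finset.card_insert_of_notMem hi]; omega)
    -- The class of `a` is killed by a power of `x i`, while multiplication by `x i` is injective on
    -- `H^k(S)` by the vanishing for `S/x_i` one degree lower.
    obtain ⟨N, hN⟩ := exists_pow_smul_mem_cechB hregi ha
    induction N with
    | zero => simpa using hN
    | succ N ihN =>
      rw [pow_succ', mul_smul] at hN
      refine ihN (mem_cechB_of_smul_mem_cechB hφ hy hy' hregi (fun l hl => hvan l (by omega)) hN)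

end Vanishing

/-! ### Top local cohomology of `R` as fractions. -/

section Top

variable {R : Type u} [CommRing R] {m : ℕ} {x : Fin (m + 1) → R}

/-- The value of a Čech cochain of top degree on the only face. -/
abbrev cechTop {S : Type v} [CommRing S] [Algebra R S] (w : CechCochain S x (m + 1)) :
    CechLoc S x Finset.univ :=
  w ⟨Finset.univ, by simp⟩

theorem cechTop_injective {S : Type v} [CommRing S] [Algebra R S]
    {w w' : CechCochain S x (m + 1)} (h : cechTop w = cechTop w') : w = w' := by
  funext ⟨s, hs⟩
  obtain rfl : s = Finset.univ := by rw [← Finset.card_eq_iff_eq_univ, hs, Fintype.card_fin]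
  exact h

theorem prod_erase_mul (j : Fin (m + 1)) : ∏ i, x i = x j * ∏ i ∈ Finset.univ.erase j, x i :=
  (Finset.mul_prod_erase _ _ (Finset.mem_univ j)).symm

theorem prod_pow_smul_cechRes_erase {S : Type v} [CommRing S] [Algebra R S] {j : Fin (m + 1)}
    (h : Finset.univ.erase j ⊆ Finset.univ) (M : ℕ) (z : CechLoc S x (Finset.univ.erase j)) :
    (∏ i, x i) ^ M • cechRes S x h z =
      x j ^ M • cechRes S x h ((∏ i ∈ Finset.univ.erase j, x i) ^ M • z) := by
  have e : (∏ i, x i) ^ M = x j ^ M * (∏ i ∈ Finset.univ.erase j, x i) ^ M := by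
    rw [prod_erase_mul j, mul_pow]
  rw [cechRes_smul, ← mul_smul, ← e]

/-- The fraction `c / (x_1 ⋯ x_n) ^ t` is a coboundary if and only if
`c ∈ (x_1 ^ t, …, x_n ^ t)`. -/
theorem mem_range_cechD_iff [IsDomain R] (hx0 : ∀ i, x i ≠ 0)
    (hreg : ∀ (T : Finset (Fin (m + 1))) (i : Fin (m + 1)), i ∉ T → ∀ c : R,
      x i * c ∈ Ideal.span (x '' T) → c ∈ Ideal.span (x '' T))
    {w : CechCochain R x (m + 1)} {t : ℕ} {c : R}
    (hw : (∏ i, x i) ^ t • cechTop w = algebraMap R _ c) :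
    w ∈ LinearMap.range (cechD R x m) ↔ c ∈ powSpan x t := by
  classical
  constructor
  · rintro ⟨a, rfl⟩
    have hex (j : {j // j ∈ (Finset.univ : Finset (Fin (m + 1)))}) :
        ∃ (N : ℕ) (b : R), (∏ i ∈ Finset.univ.erase j.1, x i) ^ N •
          a ⟨Finset.univ.erase j.1, by simp⟩ = algebraMap R _ b := CechLoc.exists_smul_eq _
    choose N b hb using hex
    set M := Finset.univ.sup N
    -- The component at `univ \ {j}` has no `x j` in its denominator, so over `(∏ x) ^ M` its
    -- numerator acquires the factor `x j ^ M`.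
    have hterm (j : {j // j ∈ (Finset.univ : Finset (Fin (m + 1)))}) :
        ∃ d : R, (∏ i, x i) ^ M • (-1 : R) ^ below Finset.univ j.1 •
          cechRes R x (Finset.erase_subset j.1 Finset.univ)
            (a ⟨Finset.univ.erase j.1, by simp⟩) = algebraMap R _ (x j.1 ^ M * d) := by
      have hj : N j ≤ M := Finset.le_sup (Finset.mem_univ j)
      refine ⟨(-1 : R) ^ below Finset.univ j.1 *
        ((∏ i ∈ Finset.univ.erase j.1, x i) ^ (M - N j) * b j), ?_⟩
      have h1 : (∏ i ∈ Finset.univ.erase j.1, x i) ^ M • a ⟨Finset.univ.erase j.1, by simp⟩ =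
          algebraMap R (CechLoc R x (Finset.univ.erase j.1))
            ((∏ i ∈ Finset.univ.erase j.1, x i) ^ (M - N j) * b j) := by
        rw [← smul_eq_mul, CechLoc.algebraMap_smul]
        refine Eq.trans ?_ (congrArg (fun z : CechLoc R x (Finset.univ.erase j.1) =>
          (∏ i ∈ Finset.univ.erase j.1, x i) ^ (M - N j) • z) (hb j))
        rw [← mul_smul, ← pow_add, Nat.sub_add_cancel hj]
      rw [smul_comm, prod_pow_smul_cechRes_erase, h1, cechRes_algebraMap, smul_comm,
        ← CechLoc.algebraMap_smul, ← CechLoc.algebraMap_smul, smul_eq_mul, smul_eq_mul]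
    choose d hd using hterm
    have h1 : (∏ i, x i) ^ M • cechTop (cechD R x m a) =
        algebraMap R _ (∑ j, x j.1 ^ M * d j) := by
      rw [cechTop, cechD_apply, Finset.smul_sum, map_sum]
      exact Finset.sum_congr rfl fun j _ => hd j
    have h2 : algebraMap R (CechLoc R x Finset.univ)
        ((∏ i, x i) ^ M * c - (∏ i, x i) ^ t * ∑ j, x j.1 ^ M * d j) = 0 := by
      rw [map_sub, ← smul_eq_mul, ← smul_eq_mul, CechLoc.algebraMap_smul, CechLoc.algebraMap_smul,
        ← hw, ← h1, smul_comm, sub_self]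
    obtain ⟨K, hK⟩ := CechLoc.exists_smul_eq_zero h2
    have h3 := (mul_eq_zero.1 hK).resolve_left
      (pow_ne_zero _ (Finset.prod_ne_zero_iff.2 fun i _ => hx0 i))
    -- Cross-multiplication gave `(∏ x) ^ M c = (∏ x) ^ t ∑ x_j ^ M d_j`, which lies in `(x_j ^ (t +
    -- M))`.
    refine mem_powSpan_of_prod_pow_mul_mem hreg (k := M) ?_
    rw [sub_eq_zero.1 h3, Finset.mul_sum]
    refine Ideal.sum_mem _ fun j _ => ?_
    have e : (∏ i, x i) ^ t * (x j.1 ^ M * d j) =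
        (∏ i ∈ Finset.univ.erase j.1, x i) ^ t * d j * x j.1 ^ (t + M) := by
      rw [prod_erase_mul j.1, mul_pow, pow_add]; ring
    rw [e]
    exact Ideal.mul_mem_left _ _ (Ideal.subset_span ⟨j.1, rfl⟩)
  · intro hc
    obtain ⟨u, hu⟩ := (Ideal.mem_span_range_iff_exists_fun).1 hc
    -- For `c = ∑ u_j x_j ^ t` the cochain has component `± u_j / (∏_{i ≠ j} x_i) ^ t` at `univ \
    -- {j}`; the sign cancels the one in the differential.
    have hex (s : {s : Finset (Fin (m + 1)) // s.card = m}) : ∃ b : CechLoc R x s.1,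
        ∀ j, s.1 = Finset.univ.erase j →
          (∏ i ∈ s.1, x i) ^ t • b = algebraMap R _ ((-1) ^ below Finset.univ j * u j) := by
      by_cases h : ∃ j, s.1 = Finset.univ.erase j
      · obtain ⟨j, hj⟩ := h
        obtain ⟨b, hb⟩ := CechLoc.exists_eq_smul (S := R) (x := x) s.1 t
          ((-1) ^ below Finset.univ j * u j)
        refine ⟨b, fun j' hj' => ?_⟩
        obtain rfl : j = j' := by
          by_contra hne
          have h1 : j ∈ s.1 := by rw [hj']; simp [hne]
          rw [hj] at h1
          simp at h1
        exact hb
      · exact ⟨0, fun j hj => absurd ⟨j, hj⟩ h⟩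
    choose a ha using hex
    refine ⟨a, cechTop_injective ?_⟩
    refine CechLoc.smul_cancel (c := (∏ i, x i) ^ t) dvd_rfl ?_
    rw [hw, cechTop, cechD_apply, Finset.smul_sum, ← hu, map_sum]
    refine Eq.trans ?_ (Finset.sum_coe_sort Finset.univ
      fun j => algebraMap R (CechLoc R x Finset.univ) (u j * x j ^ t))
    refine Finset.sum_congr rfl fun j _ => ?_
    have h1 := ha ⟨Finset.univ.erase j.1, by simp⟩ j.1 rfl
    have h2 : (∏ i, x i) ^ t • cechRes R x (Finset.erase_subset j.1 Finset.univ)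
        (a ⟨Finset.univ.erase j.1, by simp⟩) =
        algebraMap R _ (x j.1 ^ t * ((-1) ^ below Finset.univ j.1 * u j.1)) := by
      rw [prod_pow_smul_cechRes_erase]
      refine (congrArg (fun z => x j.1 ^ t • cechRes R x _ z) h1).trans ?_
      rw [cechRes_algebraMap, ← CechLoc.algebraMap_smul, smul_eq_mul]
    rw [smul_comm, h2, ← CechLoc.algebraMap_smul, smul_eq_mul]
    congr 1
    have h3 : (-1 : R) ^ below Finset.univ j.1 * (-1) ^ below Finset.univ j.1 = 1 := by
      rw [← mul_pow]; simp
    linear_combination (x j.1 ^ t * u j.1) * h3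

end Top

/-! ### Frobenius on a hypersurface through the connecting map. -/

section Hypersurface

variable {R : Type u} [CommRing R] (p : ℕ) [Fact p.Prime] [CharP R p] {r : ℕ} {x : Fin r → R}

theorem cechMap_cechFrobeniusCochain {S S' : Type v} [CommRing S] [Algebra R S] [CommRing S']
    [Algebra R S'] (φ : S →ₐ[R] S') (k : ℕ) (a : CechCochain S x k) :
    cechMap x φ k (cechFrobeniusCochain p S x k a) =
      cechFrobeniusCochain p S' x k (cechMap x φ k a) :=
  funext fun s => map_pow (cechLocMap x φ s.1) (a s) p

theorem injective_cechFrobenius_iff_forall_cechZ {S : Type v} [CommRing S] [Algebra R S] (k : ℕ) :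
    Function.Injective (cechFrobenius p S x k) ↔
      ∀ a ∈ cechZ S x k, cechFrobeniusCochain p S x k a ∈ cechB S x k → a ∈ cechB S x k := by
  have hzero (a : cechZ S x k) : (Submodule.Quotient.mk a : CechH S x k) = 0 ↔
      a.1 ∈ cechB S x k := Submodule.Quotient.mk_eq_zero _
  rw [injective_iff_map_eq_zero]
  constructor
  · intro h a ha haB
    refine (hzero ⟨a, ha⟩).1 (h _ ?_)
    exact (hzero (cechFrobeniusZ p S x k ⟨a, ha⟩)).2 haB
  · intro h a
    obtain ⟨⟨a, ha⟩, rfl⟩ := Submodule.Quotient.mk_surjective _ a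
    intro h0
    exact (hzero ⟨a, ha⟩).2 (h a ha ((hzero (cechFrobeniusZ p S x k ⟨a, ha⟩)).1 h0))

/-- The Frobenius action on `H^k(R / f)` corresponds to `f ^ (p - 1) F` on the kernel of `f` on
`H^(k + 1)(R)` if `H^k(R) = 0`. -/
theorem injective_cechFrobenius_iff {f : R} (hf : ∀ c : R, f * c = 0 → c = 0) {k : ℕ}
    (hvan : cechZ R x k ≤ cechB R x k) :
    Function.Injective (cechFrobenius p (R ⧸ Ideal.span {f}) x k) ↔
      ∀ b : CechCochain R x (k + 1), f • b ∈ LinearMap.range (cechD R x k) →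
        f ^ (p - 1) • cechFrobeniusCochain p R x (k + 1) b ∈ LinearMap.range (cechD R x k) →
        b ∈ LinearMap.range (cechD R x k) := by
  rw [injective_cechFrobenius_iff_forall_cechZ]
  let φ : R →ₐ[R] R ⧸ Ideal.span {f} := Algebra.ofId R _
  have hφ : Function.Surjective φ := Ideal.Quotient.mk_surjective
  have hker : ∀ c : R, φ c = 0 → ∃ d, c = f • d := by
    intro c hc
    obtain ⟨d, rfl⟩ := Ideal.mem_span_singleton'.1 (Ideal.Quotient.eq_zero_iff_mem.1 hc)
    exact ⟨d, mul_comm _ _⟩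
  have hann : ∀ c : R ⧸ Ideal.span {f}, f • c = 0 := by
    intro c
    obtain ⟨c, rfl⟩ := Ideal.Quotient.mk_surjective c
    exact Ideal.Quotient.eq_zero_iff_mem.2
      (Ideal.mul_mem_right _ _ (Ideal.mem_span_singleton_self f))
  -- The connecting map sends the class of `a` modulo `f` to that of `b`. It is well defined by
  -- cancelling `f`, and injective since `H^k(R) = 0`.
  have hcob : ∀ (a : CechCochain R x k) (b : CechCochain R x (k + 1)),
      cechD R x k a = f • b → (cechMap x φ k a ∈ cechB (R ⧸ Ideal.span {f}) x k ↔
        b ∈ LinearMap.range (cechD R x k)) := by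
    intro a b hab
    constructor
    · intro h
      obtain ⟨e, he, c, rfl⟩ := exists_cechB_of_cechMap_mem_cechB x hφ hker h
      refine ⟨c, cechCochain_smul_cancel hf ?_⟩
      rw [← hab, map_add, map_smul, show cechD R x k e = 0 from cechB_le_cechZ R x k he, zero_add]
    · rintro ⟨c, rfl⟩
      have h1 : a - f • c ∈ cechB R x k := hvan <| by
        change cechD R x k _ = 0
        rw [map_sub, map_smul, hab, sub_self]
      have h2 := cechMap_mem_cechB x φ h1
      rwa [map_sub, cechMap_smul_eq_zero x hann, sub_zero] at h2
  -- Applying `F` to `d a = f b` gives `f ^ p F b = f (f ^ (p - 1) F b)`, whence the twist by `f ^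
  -- (p - 1)`.
  have hfrob : ∀ (a : CechCochain R x k) (b : CechCochain R x (k + 1)),
      cechD R x k a = f • b → cechD R x k (cechFrobeniusCochain p R x k a) =
        f • f ^ (p - 1) • cechFrobeniusCochain p R x (k + 1) b := by
    intro a b hab
    rw [cechD_cechFrobeniusCochain, hab, map_smulₛₗ, frobenius_def, ← mul_smul, ← pow_succ',
      Nat.sub_add_cancel (Fact.out : p.Prime).one_le]
  constructor
  · rintro h b ⟨a, ha⟩ hb
    rw [← hcob a b ha]
    refine h _ ?_ ?_
    · change cechD _ x k _ = 0
      rw [cechD_cechMap, ha, cechMap_smul_eq_zero x hann]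
    · rw [← cechMap_cechFrobeniusCochain]
      exact (hcob _ _ (hfrob a b ha)).2 hb
  · intro h a ha haB
    obtain ⟨a, rfl⟩ := cechMap_surjective x hφ k a
    obtain ⟨b, hb⟩ := exists_smul_eq_of_cechMap_eq_zero x hker (a := cechD R x k a) (by
      rw [← cechD_cechMap]; exact ha)
    rw [← cechMap_cechFrobeniusCochain] at haB
    exact (hcob a b hb).2 (h b ⟨a, hb⟩ ((hcob _ _ (hfrob a b hb)).1 haB))

end Hypersurface

/-! ### Frobenius powers of the maximal ideal -/

section FrobeniusPower

variable {R : Type u} [CommRing R] (p : ℕ) [Fact p.Prime] [CharP R p] {n : ℕ} {x : Fin n → R}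

/-- The iterated Frobenius is a ring homomorphism, so it suffices to check generators. -/
theorem pow_mem_powSpan {t : ℕ} {c : R} (hc : c ∈ powSpan x t) (e : ℕ) :
    c ^ p ^ e ∈ powSpan x (t * p ^ e) := by
  have : powSpan x t ≤ (powSpan x (t * p ^ e)).comap (iterateFrobenius R p e) := by
    refine Ideal.span_le.2 ?_
    rintro _ ⟨j, rfl⟩
    refine Ideal.subset_span ⟨j, ?_⟩
    simp [iterateFrobenius_def, pow_mul]
  exact this hc

theorem frobeniusPower_span_range (e : ℕ) :
    frobeniusPower (Ideal.span (Set.range x)) (p ^ e) = powSpan x (p ^ e) := by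
  apply le_antisymm
  · refine Ideal.span_le.2 ?_
    rintro _ ⟨y, hy, rfl⟩
    have := pow_mem_powSpan p (x := x) (t := 1) (c := y) (by simpa [powSpan] using hy) e
    rwa [one_mul] at this
  · refine Ideal.span_mono ?_
    rintro _ ⟨j, rfl⟩
    exact ⟨x j, Ideal.subset_span ⟨j, rfl⟩, rfl⟩

theorem prod_pow_mul_mem_powSpan {t : ℕ} {c : R} (hc : c ∈ powSpan x t) (k : ℕ) :
    (∏ i, x i) ^ k * c ∈ powSpan x (t + k) := by
  classical
  obtain ⟨u, rfl⟩ := (Ideal.mem_span_range_iff_exists_fun).1 hc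
  rw [Finset.mul_sum]
  refine Ideal.sum_mem _ fun j _ => ?_
  have e : (∏ i, x i) ^ k * (u j * x j ^ t) =
      u j * (∏ i ∈ Finset.univ.erase j, x i) ^ k * x j ^ (t + k) := by
    rw [← Finset.mul_prod_erase _ _ (Finset.mem_univ j)]; ring
  rw [e]
  exact Ideal.mul_mem_left _ _ (Ideal.subset_span ⟨j, rfl⟩)

/-- Contrapositive: Frobenius turns `f ^ (p - 1) ∈ (x_i ^ p)` into `f ^ ((p - 1) p ^ (e - 1)) ∈ (x_i
^ (p ^ e))`, and this exponent is at most `p ^ e - 1`. -/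
theorem pow_sub_one_notMem_powSpan_of_pow {f : R} {e : ℕ} (he : 1 ≤ e)
    (h : f ^ (p ^ e - 1) ∉ powSpan x (p ^ e)) : f ^ (p - 1) ∉ powSpan x p := by
  intro hf
  obtain ⟨e, rfl⟩ : ∃ d, e = d + 1 := ⟨e - 1, by omega⟩
  have h1 := pow_mem_powSpan p hf e
  rw [← pow_mul, ← pow_succ'] at h1
  refine h (Ideal.pow_mem_of_pow_mem _ h1 ?_)
  rw [Nat.sub_mul, one_mul, pow_succ']
  have := Nat.pos_of_ne_zero (pow_ne_zero e (Fact.out : p.Prime).ne_zero)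
  omega

theorem one_notMem_powSpan_one [IsLocalRing R] (hx : Ideal.span (Set.range x) = maximalIdeal R) :
    (1 : R) ∉ powSpan x 1 := by
  have e : powSpan x 1 = maximalIdeal R := by simp [powSpan, hx]
  rw [e]
  exact (Ideal.ne_top_iff_one _).1 (maximalIdeal.isMaximal R).ne_top

theorem pow_sub_one_notMem_powSpan [IsLocalRing R]
    (hx : Ideal.span (Set.range x) = maximalIdeal R)
    (hreg : ∀ (T : Finset (Fin n)) (i : Fin n), i ∉ T → ∀ c : R,
      x i * c ∈ Ideal.span (x '' T) → c ∈ Ideal.span (x '' T))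
    {f : R} (h : f ^ (p - 1) ∉ powSpan x p) (e : ℕ) :
    f ^ (p ^ e - 1) ∉ powSpan x (p ^ e) := by
  have hp : p - 1 + 1 = p := Nat.sub_add_cancel (Fact.out : p.Prime).one_le
  obtain ⟨g, hg⟩ : ∃ g, g * f ^ (p - 1) - (∏ j, x j) ^ (p - 1) ∈ powSpan x p := by
    have := exists_mul_sub_prod_pow_mem_powSpan hx (t := p - 1) (c := f ^ (p - 1))
      (by rwa [hp])
    rwa [hp] at this
  have hq : ∀ e, 1 ≤ p ^ e := fun e =>
    Nat.pos_of_ne_zero (pow_ne_zero e (Fact.out : p.Prime).ne_zero)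
  -- With `q = p ^ e`: the `q`-th power of the congruence `hg` is combined with the one for `q`
  -- multiplied by `(∏ x) ^ ((p - 1) q)`, using `p q - 1 = (p - 1) q + (q - 1)`.
  have key : ∃ w, w * f ^ (p ^ e - 1) - (∏ j, x j) ^ (p ^ e - 1) ∈ powSpan x (p ^ e) := by
    induction e with
    | zero => exact ⟨1, by simp⟩
    | succ e ih =>
      obtain ⟨w, hw⟩ := ih
      have h1 := pow_mem_powSpan p hg e
      rw [sub_pow_char_pow, mul_pow, ← pow_mul, ← pow_mul, ← pow_succ'] at h1
      have h2 := prod_pow_mul_mem_powSpan hw ((p - 1) * p ^ e)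
      have hexp : p ^ e + (p - 1) * p ^ e = p ^ (e + 1) := by
        rw [pow_succ', add_comm, ← Nat.succ_mul, Nat.succ_eq_add_one, hp]
      rw [hexp] at h2
      have hexp' : p ^ (e + 1) - 1 = (p - 1) * p ^ e + (p ^ e - 1) := by
        have := hq e
        omega
      refine ⟨g ^ p ^ e * w, ?_⟩
      have h3 := Ideal.add_mem _ (Ideal.mul_mem_left _ (w * f ^ (p ^ e - 1)) h1) h2
      rw [hexp', pow_add f, pow_add (∏ j, x j)]
      convert h3 using 1
      ring
  intro hmem
  obtain ⟨w, hw⟩ := key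
  -- Otherwise `(∏ x) ^ (q - 1) ∈ (x_i ^ q)`, and cancellation would put `1` in `𝔪`.
  have h1 : (∏ j, x j) ^ (p ^ e - 1) * 1 ∈ powSpan x (1 + (p ^ e - 1)) := by
    rw [Nat.add_sub_cancel' (hq e), mul_one]
    simpa using Ideal.sub_mem _ (Ideal.mul_mem_left _ w hmem) hw
  exact one_notMem_powSpan_one hx (mem_powSpan_of_prod_pow_mul_mem hreg h1)

end FrobeniusPower

/-- Fedder's criterion for the Frobenius action on the top local cohomology of a hypersurface. -/
theorem injective_cechFrobenius_iff_pow_notMem {R : Type u} [CommRing R] [IsDomain R]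
    [IsLocalRing R] (p : ℕ) [Fact p.Prime] [CharP R p] {m : ℕ} {x : Fin (m + 1) → R}
    (hx : Ideal.span (Set.range x) = maximalIdeal R) (hx0 : ∀ i, x i ≠ 0)
    (hreg : ∀ (T : Finset (Fin (m + 1))) (i : Fin (m + 1)), i ∉ T → ∀ c : R,
      x i * c ∈ Ideal.span (x '' T) → c ∈ Ideal.span (x '' T))
    {f : R} (hf0 : f ≠ 0) (hf : f ∈ maximalIdeal R) :
    Function.Injective (cechFrobenius p (R ⧸ Ideal.span {f}) x m) ↔
      f ^ (p - 1) ∉ powSpan x p := by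
  have hvan : cechZ R x m ≤ cechB R x m :=
    cechZ_le_cechB hreg (m + 1) ∅ R Function.surjective_id (by simp) (by simp) m (by omega)
  rw [injective_cechFrobenius_iff p (fun c hc => (mul_eq_zero.1 hc).resolve_left hf0) hvan]
  have hsmul : ∀ {b : CechCochain R x (m + 1)} {t : ℕ} {c : R} (g : R),
      (∏ i, x i) ^ t • cechTop b = algebraMap R _ c →
      (∏ i, x i) ^ t • cechTop (g • b) = algebraMap R _ (g * c) := by
    intro b t c g h
    rw [← smul_eq_mul, CechLoc.algebraMap_smul, ← h, smul_comm]
    rfl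
  have hfrob : ∀ {b : CechCochain R x (m + 1)} {t : ℕ} {c : R},
      (∏ i, x i) ^ t • cechTop b = algebraMap R _ c →
      (∏ i, x i) ^ (t * p) • cechTop (cechFrobeniusCochain p R x (m + 1) b) =
        algebraMap R _ (c ^ p) := by
    intro b t c h
    rw [map_pow, ← h, smul_pow, ← pow_mul]
    rfl
  constructor
  · intro h hfp
    -- The test class is `1 / ∏ x`: it is nonzero and killed by `f ∈ 𝔪`, and its image under `f ^ (p
    -- - 1) F` is `f ^ (p - 1) / (∏ x) ^ p`.
    obtain ⟨z, hz⟩ := CechLoc.exists_eq_smul (S := R) (x := x) Finset.univ 1 1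
    obtain ⟨b, rfl⟩ : ∃ b : CechCochain R x (m + 1), cechTop b = z := by
      have hs (s : {s : Finset (Fin (m + 1)) // s.card = m + 1}) : s.1 = Finset.univ := by
        rw [← Finset.card_eq_iff_eq_univ, s.2, Fintype.card_fin]
      exact ⟨fun s => (hs s).symm ▸ z, rfl⟩
    have h1 := h b
    rw [mem_range_cechD_iff hx0 hreg (hsmul f hz),
      mem_range_cechD_iff hx0 hreg (hsmul _ (hfrob hz)), mem_range_cechD_iff hx0 hreg hz] at h1
    refine one_notMem_powSpan_one hx (h1 ?_ ?_)
    · simpa [powSpan, hx] using hf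
    · simpa using hfp
  · intro hfp b hfb hfrb
    obtain ⟨t, c, hc⟩ := CechLoc.exists_smul_eq (cechTop b)
    rw [mem_range_cechD_iff hx0 hreg (hsmul _ (hfrob hc))] at hfrb
    rw [mem_range_cechD_iff hx0 hreg hc]
    by_contra hcx
    cases t with
    -- Exponent zero makes `powSpan x 0` the unit ideal, because there is at least one parameter.
    | zero => exact hcx (Ideal.subset_span ⟨0, by simp⟩ |> fun h1 : (1 : R) ∈ powSpan x 0 =>
        (Ideal.eq_top_iff_one _).2 h1 ▸ Submodule.mem_top)
    | succ t =>
      -- Here `g c ≡ (∏ x) ^ t`. Its `p`-th power with `hfrb` gives `(∏ x) ^ (t p) f ^ (p - 1) ∈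
      -- (x_i ^ ((t + 1) p))`, and `(∏ x) ^ (t p)` cancels.
      obtain ⟨g, hg⟩ := exists_mul_sub_prod_pow_mem_powSpan hx hcx
      have h1 := pow_mem_powSpan p hg 1
      rw [pow_one, sub_pow_char, mul_pow, ← pow_mul] at h1
      refine hfp (mem_powSpan_of_prod_pow_mul_mem hreg (k := t * p) ?_)
      have h2 := Ideal.sub_mem _ (Ideal.mul_mem_left _ (g ^ p) hfrb)
        (Ideal.mul_mem_left _ (f ^ (p - 1)) h1)
      rw [show p + t * p = (t + 1) * p by ring]
      convert h2 using 1
      ring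

/-! ### The F-pure threshold -/

section Threshold

variable {R : Type u} [CommRing R] [IsLocalRing R] (p : ℕ) [Fact p.Prime]

theorem nuElem_eq_sub_one_iff {f : R} (hf : f ∈ maximalIdeal R) {q : ℕ} (hq : q ≠ 0) :
    nuElem f q = q - 1 ↔ f ^ (q - 1) ∉ frobeniusPower (maximalIdeal R) q := by
  obtain ⟨⟨h1, h2⟩, h3⟩ := isGreatest_nuElem hf hq
  constructor
  · intro h; rw [← h]; exact h1
  · intro h
    have := h2 h
    omega

/-- There is a gap: either `ν(q) / q ≤ 1 - 1/p` for all `q = p ^ e` with `e ≥ 1`, or `ν(q) = q - 1`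
for all `q`. -/
theorem pureThreshold_eq_one_iff [CharP R p] {n : ℕ} {x : Fin n → R}
    (hx : Ideal.span (Set.range x) = maximalIdeal R)
    (hreg : ∀ (T : Finset (Fin n)) (i : Fin n), i ∉ T → ∀ c : R,
      x i * c ∈ Ideal.span (x '' T) → c ∈ Ideal.span (x '' T))
    {f : R} (hf : f ∈ maximalIdeal R) :
    pureThreshold p f = 1 ↔ f ^ (p - 1) ∉ powSpan x p := by
  have hp : p.Prime := Fact.out
  have hp0 : (0 : ℝ) < p := by exact_mod_cast hp.pos
  have hq0 : ∀ e, p ^ e ≠ 0 := fun e => pow_ne_zero e hp.ne_zero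
  have hlim := tendsto_pureThreshold p hf
  have hfp : ∀ e, frobeniusPower (maximalIdeal R) (p ^ e) = powSpan x (p ^ e) := fun e => by
    rw [← hx, frobeniusPower_span_range]
  constructor
  · intro hc hmem
    have hbound : ∀ e, 1 ≤ e → (nuElem f (p ^ e) : ℝ) / (p : ℝ) ^ e ≤ 1 - 1 / p := by
      intro e he
      obtain ⟨e, rfl⟩ : ∃ d, e = d + 1 := ⟨e - 1, by omega⟩
      have h1 := pow_mem_powSpan p hmem e
      rw [← pow_mul, ← pow_succ'] at h1
      have h2 : nuElem f (p ^ (e + 1)) ≤ (p - 1) * p ^ e := by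
        by_contra! hlt
        obtain ⟨⟨h3, -⟩, -⟩ := isGreatest_nuElem hf (hq0 (e + 1))
        refine h3 ?_
        rw [hfp]
        exact Ideal.pow_mem_of_pow_mem _ h1 hlt.le
      have h3 : (nuElem f (p ^ (e + 1)) : ℝ) ≤ ((p : ℝ) - 1) * (p : ℝ) ^ e := by
        have h4 : ((p - 1 : ℕ) : ℝ) = (p : ℝ) - 1 := by
          rw [Nat.cast_sub hp.one_le, Nat.cast_one]
        rw [← h4]
        exact_mod_cast h2
      rw [div_le_iff₀ (by positivity)]
      refine h3.trans (le_of_eq ?_)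
      rw [pow_succ]
      field_simp
    have h1 := le_of_tendsto hlim (eventually_atTop.2 ⟨1, hbound⟩)
    rw [hc] at h1
    have : (0 : ℝ) < 1 / p := by positivity
    linarith
  · intro h
    have hnu : ∀ e, nuElem f (p ^ e) = p ^ e - 1 := fun e => by
      rw [nuElem_eq_sub_one_iff hf (hq0 e), hfp]
      exact pow_sub_one_notMem_powSpan p hx hreg h e
    refine tendsto_nhds_unique hlim ?_
    have hinv : Tendsto (fun e : ℕ => ((p : ℝ)⁻¹) ^ e) atTop (𝓝 0) :=
      tendsto_pow_atTop_nhds_zero_of_lt_one (by positivity)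
        (inv_lt_one_of_one_lt₀ (by exact_mod_cast hp.one_lt))
    have h1 := (tendsto_const_nhds (x := (1 : ℝ))).sub hinv
    rw [sub_zero] at h1
    refine h1.congr fun e => ?_
    rw [hnu, Nat.cast_sub (Nat.one_le_iff_ne_zero.2 (hq0 e)), Nat.cast_pow, Nat.cast_one,
      sub_div, div_self (by positivity), inv_pow, one_div]

/-- The bound `1 ≤ e` matters: for `e = 0` the equality reads `0 = 0` and always holds. -/
theorem pureThreshold_eq_one_iff_exists_nuElem [CharP R p] {n : ℕ} {x : Fin n → R}
    (hx : Ideal.span (Set.range x) = maximalIdeal R)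
    (hreg : ∀ (T : Finset (Fin n)) (i : Fin n), i ∉ T → ∀ c : R,
      x i * c ∈ Ideal.span (x '' T) → c ∈ Ideal.span (x '' T))
    {f : R} (hf : f ∈ maximalIdeal R) :
    pureThreshold p f = 1 ↔ ∃ e : ℕ, 1 ≤ e ∧ nuElem f (p ^ e) = p ^ e - 1 := by
  have hq0 : ∀ e, p ^ e ≠ 0 := fun e => pow_ne_zero e (Fact.out : p.Prime).ne_zero
  have hnu : ∀ e, nuElem f (p ^ e) = p ^ e - 1 ↔ f ^ (p ^ e - 1) ∉ powSpan x (p ^ e) := fun e => by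
    rw [nuElem_eq_sub_one_iff hf (hq0 e), ← hx, frobeniusPower_span_range]
  rw [pureThreshold_eq_one_iff p hx hreg hf]
  constructor
  · intro h
    exact ⟨1, le_rfl, (hnu 1).2 (by rwa [pow_one])⟩
  · rintro ⟨e, he, h⟩
    exact pow_sub_one_notMem_powSpan_of_pow p he ((hnu e).1 h)

end Threshold

theorem exists_fin_span_range_eq_maximalIdeal {R : Type u} [CommRing R] [IsRegularLocalRing R]
    {n : ℕ} (hn : ringKrullDim R = n) :
    ∃ x : Fin n → R, Ideal.span (Set.range x) = maximalIdeal R := by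
  have hfg : (maximalIdeal R).FG := IsNoetherian.noetherian _
  have h1 : (maximalIdeal R).spanFinrank = n := by
    have h := IsRegularLocalRing.spanFinrank_maximalIdeal (R := R)
    rw [hn] at h
    exact_mod_cast h
  have hfin := Submodule.FG.finite_generators hfg
  have hcard : Nat.card (maximalIdeal R).generators = n := by
    rw [Nat.card_coe_set_eq, Submodule.FG.generators_ncard hfg, h1]
  have : Finite (maximalIdeal R).generators := hfin
  refine ⟨fun i => ((Finite.equivFinOfCardEq hcard).symm i).1, ?_⟩
  have h2 : Set.range (fun i => ((Finite.equivFinOfCardEq hcard).symm i).1) =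
      (maximalIdeal R).generators := by
    change Set.range (Subtype.val ∘ (Finite.equivFinOfCardEq hcard).symm) = _
    rw [EquivLike.range_comp, Subtype.range_coe]
  rw [h2]
  exact (maximalIdeal R).span_generators

end FThreshold

end

theorem mainTheorem9 {R : Type*} [CommRing R] [IsRegularLocalRing R] (p : ℕ) [Fact p.Prime]
    [CharP R p] (n : ℕ) (hn : ringKrullDim R = n) (f : R) (hf0 : f ≠ 0)
    (hf : f ∈ maximalIdeal R) :
    (FThreshold.pureThreshold p f = 1 ↔
      ∃ e : ℕ, 1 ≤ e ∧ FThreshold.nuElem f (p ^ e) = p ^ e - 1) ∧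
    ∀ x : Fin n → R, Ideal.span (Set.range x) = maximalIdeal R →
      (FThreshold.pureThreshold p f = 1 ↔
        Function.Injective
          (FThreshold.cechFrobenius p (R ⧸ Ideal.span {f}) x (n - 1))) := by
  constructor
  · obtain ⟨x, hx⟩ := FThreshold.exists_fin_span_range_eq_maximalIdeal hn
    exact FThreshold.pureThreshold_eq_one_iff_exists_nuElem p hx
      (fun _ _ hi _ hc => FThreshold.mem_span_image_of_mul_mem hn hx hi hc) hf
  · intro x hx
    have hreg : ∀ (T : Finset (Fin n)) (i : Fin n), i ∉ T → ∀ c : R,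
        x i * c ∈ Ideal.span (x '' T) → c ∈ Ideal.span (x '' T) :=
      fun _ _ hi _ hc => FThreshold.mem_span_image_of_mul_mem hn hx hi hc
    have hdom : IsDomain R := FThreshold.isDomain_of_span_card x hx (by rw [hn, Fintype.card_fin])
    -- A nonzero `f ∈ 𝔪` excludes `n = 0`, so the truncated `n - 1` is a genuine subtraction.
    obtain ⟨m, rfl⟩ : ∃ m, n = m + 1 := by
      refine Nat.exists_eq_succ_of_ne_zero ?_
      rintro rfl
      rw [← hx, Set.range_eq_empty, Ideal.span_empty] at hf
      exact hf0 hf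
    have hx0 : ∀ i, x i ≠ 0 := by
      intro i h0
      -- Regularity modulo the empty set of parameters: `x i = 0` would put `1` in the zero ideal.
      have h1 := hreg ∅ i (Finset.notMem_empty i) 1 (by simp [h0])
      simp at h1
    rw [FThreshold.pureThreshold_eq_one_iff p hx hreg hf]
    exact (FThreshold.injective_cechFrobenius_iff_pow_notMem p hx hx0 hreg hf0 hf).symm
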